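/- Let $n\ge 1$, let $X=\mathbb{Z}^{n+1}/\mathbb{Z}(1,\dots,1)$ be the weight lattice of $SL_{n+1}(\mathbb{C})$, with root system $\Phi$ of type $A_n$ and Weyl group $W$ (the symmetric group $S_{n+1}$), and let $W_{ext}=W\ltimes X$ be the extended affine Weyl group, acting on $X$ by affine transformations. For a real affine root $\alpha^\vee=k\delta+\beta^\vee$ ($k\in\mathbb{Z}$, $\beta\in\Phi$) let $s_{\alpha^\vee}\in W_{ext}$ be the reflection $\mu\mapsto\mu-(\langle\mu,\beta^\vee\rangle-k)\beta$; call $\alpha^\vee$ positive if $k>0$, or $k=0$ and $\beta$ is positive. Let $s_1,\dots,s_n$ be the reflections in the simple roots and $s_0$ the reflection for $\delta-\theta^\vee$, where $\theta^\vee$ is the highest coroot. For $w\in W_{ext}$ let $N(w)$ be the set of positive real affine roots sent to negative roots by $w^{-1}$, and $\ell(w)=|N(w)|$. For $m\ge 0$ let $y_m$ be the product of the first $m$ letters of the infinite word $(s_0s_1\cdots s_n)^\infty$, and let $t_{m+1}=y_{m+1}y_m^{-1}$, a reflection. Put $\ell_m(w)=\ell(w)-2|N(w)\cap N(y_m)|+|N(y_m)|$,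 and let $\le_m$ be the partial order on $W_{ext}$ generated by $w<_m rw$ for reflections $r=s_{\alpha^\vee}$ with $\ell_m(w)<\ell_m(rw)$. For $\mu\in X$ let $\mu_m$ be the element of minimal $\ell_m$ in the coset $\mathtt{t}_\mu W$, where $\mathtt{t}_\mu$ is the translation by $\mu$, and define $\mu\le_m\nu$ if and only if $\mu_m\le_m\nu_m$; for $m=0$ this is the Bruhat order $\le$ on $X$. For dominant $\lambda\in X$ let $\Gamma^m_\lambda$ be the directed graph whose vertices are the weights $\mu\le\lambda$, with an arrow $\mu\to\nu$ if $\mu<_m\nu$ and $\nu=s_{\alpha^\vee}(\mu)$ for some real affine root $\alpha^\vee$. (Equivalently, it is the restriction to the weights $\le\lambda$ of the Bruhat graph of $X$, with all edges labeled by the roots in $N(y_m)$ reversed.) **Proposition.** Let $m\ge 0$ and $t=t_{m+1}$. Let $\lambda\in X$ be dominant and let $\mu\in X$ be such that $\mu<t\mu\le\lambda$. Then the numbers of arrows directed to $\mu$ and to $t\mu$ in $\Gamma^m_\lambda$ are finite, and $$\#\{\text{arrows directed to }\mu\text{ in }\Gamma^m_\lambda\}=\#\{\text{arrows directed to }t\mu\text{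 in }\Gamma^m_\lambda\}-1 .$$ -/

import Mathlib

namespace AffineA

/-- The weight lattice of `SL_{n+1}`: characters of the diagonal torus, that is,
`ℤ^{n+1}` modulo the line spanned by `(1, …, 1)`. -/
abbrev Weight (n : ℕ) : Type :=
  (Fin (n + 1) → ℤ) ⧸ AddSubgroup.zmultiples (1 : Fin (n + 1) → ℤ)

/-- The pairing `⟨μ, β^∨⟩ = μ_i - μ_j` of a weight with the coroot `β^∨ = ε_i^∨ - ε_j^∨`. -/
def pair {n : ℕ} (i j : Fin (n + 1)) : Weight n →+ ℤ :=
  QuotientAddGroup.lift _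
    (Pi.evalAddMonoidHom (fun _ : Fin (n + 1) => ℤ) i - Pi.evalAddMonoidHom (fun _ => ℤ) j)
    (by
      rintro _ ⟨k, rfl⟩
      simp)

/-- The root `ε_i - ε_j`, as a weight. -/
def root {n : ℕ} (i j : Fin (n + 1)) : Weight n :=
  QuotientAddGroup.mk (Pi.single i 1 - Pi.single j 1)

/-- Dominant weights: `⟨μ, α^∨⟩ ≥ 0` for all positive coroots
`α^∨ = ε_i^∨ - ε_j^∨`, `i < j`. -/
def IsDominant {n : ℕ} (μ : Weight n) : Prop :=
  ∀ i j : Fin (n + 1), i < j → 0 ≤ pair i j μ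

/-- The finite Weyl group of type `A_n` (the symmetric group on the coordinates `0, …, n`),
acting on weights by permutation of coordinates: `(w μ)_{w i} = μ_i`. -/
def weylAct {n : ℕ} (w : Equiv.Perm (Fin (n + 1))) : Weight n ≃+ Weight n :=
  QuotientAddGroup.congr _ _
    (LinearEquiv.funCongrLeft ℤ ℤ w.symm).toAddEquiv
    (by
      refine (AddMonoidHom.map_zmultiples _ _).trans ?_
      congr 1)

/-- The action of the finite Weyl group on the (multiplicatively written) weight lattice, as a
homomorphism to the automorphism group. -/
def weylHom (n : ℕ) : Equiv.Perm (Fin (n + 1)) →* MulAut (Multiplicative (Weight n)) where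
  toFun w := AddEquiv.toMultiplicative (weylAct w)
  map_one' := by
    ext x
    induction x using QuotientAddGroup.induction_on
    rfl
  map_mul' _ _ := by
    ext x
    induction x using QuotientAddGroup.induction_on
    rfl

lemma weylAct_one {n : ℕ} (μ : Weight n) : weylAct 1 μ = μ :=
  congrArg Multiplicative.toAdd (DFunLike.congr_fun (weylHom n).map_one (Multiplicative.ofAdd μ))

lemma weylAct_mul {n : ℕ} (v w : Equiv.Perm (Fin (n + 1))) (μ : Weight n) :
    weylAct (v * w) μ = weylAct v (weylAct w μ) :=
  congrArg Multiplicative.toAdd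
    (DFunLike.congr_fun ((weylHom n).map_mul v w) (Multiplicative.ofAdd μ))

/-- The extended affine Weyl group `W_ext = W ⋉ X`. The element with translation part `λ` and
linear part `w` is `t_λ w`. -/
abbrev ExtWeyl (n : ℕ) : Type :=
  Multiplicative (Weight n) ⋊[weylHom n] Equiv.Perm (Fin (n + 1))

/-- The translation `t_λ`. -/
def transl {n : ℕ} (μ : Weight n) : ExtWeyl n :=
  SemidirectProduct.inl (Multiplicative.ofAdd μ)

/-- A finite Weyl group element, seen in `W_ext`. -/
def ofFin {n : ℕ} (w : Equiv.Perm (Fin (n + 1))) : ExtWeyl n :=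
  SemidirectProduct.inr w

/-- `W_ext` acts on `X` by affine transformations: `(t_λ w) μ = λ + w μ`. -/
instance (n : ℕ) : MulAction (ExtWeyl n) (Weight n) where
  smul x μ := x.left.toAdd + weylAct x.right μ
  one_smul μ := by
    change (0 : Weight n) + weylAct 1 μ = μ
    rw [weylAct_one, zero_add]
  mul_smul x y μ := by
    change (x.left.toAdd + weylAct x.right y.left.toAdd) + weylAct (x.right * y.right) μ =
      x.left.toAdd + weylAct x.right (y.left.toAdd + weylAct y.right μ)
    rw [weylAct_mul, map_add, add_assoc]

/-- A real root `m δ + β^∨` of the affine root system, with `m = level` and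
`β^∨ = ε_i^∨ - ε_j^∨`, `i ≠ j`. -/
@[ext]
structure AffineRoot (n : ℕ) where
  i : Fin (n + 1)
  j : Fin (n + 1)
  level : ℤ
  ne : i ≠ j

/-- `m δ + β^∨` is positive if `m > 0`, or `m = 0` and `β^∨` is a positive coroot. -/
def AffineRoot.IsPos {n : ℕ} (α : AffineRoot n) : Prop :=
  0 < α.level ∨ (α.level = 0 ∧ α.i < α.j)

lemma pair_weylAct {n : ℕ} (w : Equiv.Perm (Fin (n + 1))) (i j : Fin (n + 1)) (μ : Weight n) :
    pair (w i) (w j) (weylAct w μ) = pair i j μ := by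
  induction μ using QuotientAddGroup.induction_on with
  | H v =>
    change v (w.symm (w i)) - v (w.symm (w j)) = v i - v j
    simp

/-- `W_ext` acts on the real affine roots by
`(t_λ w) (m δ + β^∨) = (m + ⟨λ, w β^∨⟩) δ + w β^∨`. -/
instance (n : ℕ) : MulAction (ExtWeyl n) (AffineRoot n) where
  smul x α :=
    { i := x.right α.i
      j := x.right α.j
      level := α.level + pair (x.right α.i) (x.right α.j) x.left.toAdd
      ne := fun h => α.ne (x.right.injective h) }
  one_smul α := by
    refine AffineRoot.ext rfl rfl ?_
    change α.level + pair α.i α.j (0 : Weight n) = α.level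
    simp
  mul_smul x y α := by
    refine AffineRoot.ext rfl rfl ?_
    change α.level + pair (x.right (y.right α.i)) (x.right (y.right α.j))
        (x.left.toAdd + weylAct x.right y.left.toAdd) =
      (α.level + pair (y.right α.i) (y.right α.j) y.left.toAdd) +
        pair (x.right (y.right α.i)) (x.right (y.right α.j)) x.left.toAdd
    rw [map_add, pair_weylAct]
    ring

/-- The reflection `s_{m δ + β^∨} = t_{m β} s_β`, which acts on weights by
`μ ↦ μ - (⟨μ, β^∨⟩ - m) β`. The reflections of the affine Weyl group `W ⋉ ℤΦ ⊆ W_ext` are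
exactly these elements, and `α` and `-α` give the same reflection. -/
def affRefl {n : ℕ} (α : AffineRoot n) : ExtWeyl n :=
  transl (α.level • root α.i α.j) * ofFin (Equiv.swap α.i α.j)

/-- The simple affine roots: `α_0 = δ - θ^∨` with `θ^∨ = ε_0^∨ - ε_n^∨` the highest coroot, and
`α_i = ε_{i-1}^∨ - ε_i^∨` for `1 ≤ i ≤ n`. (The index `i - 1` is cyclic: `0 - 1 = n`.) -/
def simpleRoot {n : ℕ} [NeZero n] (i : Fin (n + 1)) : AffineRoot n where
  i := i - 1
  j := i
  level := if i = 0 then 1 else 0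
  ne := by simp [sub_eq_self]

/-- The word `(s_0 s_1 ⋯ s_n)^∞` : `wordPrefix m` is the product of its first `m` letters. -/
def wordPrefix {n : ℕ} [NeZero n] : ℕ → ExtWeyl n
  | 0 => 1
  | m + 1 => wordPrefix m * affRefl (simpleRoot (Fin.ofNat (n + 1) m))

/-- The inversion set `N(w)`: the positive roots `α` with `w⁻¹ α` negative. -/
def inversions {n : ℕ} (w : ExtWeyl n) : Set (AffineRoot n) :=
  {α | α.IsPos ∧ ¬ (w⁻¹ • α).IsPos}

/-- The length on the extended affine Weyl group: the number of inversions. -/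
noncomputable def length {n : ℕ} (w : ExtWeyl n) : ℕ :=
  (inversions w).ncard

/-- The `B`-twisted length `ℓ(w) - 2 |N(w) ∩ B| + |B|`, for a finite set `B` of positive roots. -/
noncomputable def twistedLength {n : ℕ} (B : Set (AffineRoot n)) (w : ExtWeyl n) : ℤ :=
  (length w : ℤ) - 2 * ((inversions w ∩ B).ncard : ℤ) + (B.ncard : ℤ)

/-- The `B`-twisted Bruhat order on `W_ext`, generated by `w < r w` for reflections `r` with
`ℓ_B(w) < ℓ_B(r w)`. -/
def twistedLE {n : ℕ} (B : Set (AffineRoot n)) : ExtWeyl n → ExtWeyl n → Prop :=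
  Relation.ReflTransGen fun x z =>
    ∃ α : AffineRoot n, z = affRefl α * x ∧ twistedLength B x < twistedLength B z

/-- The weight `μ`, viewed as the coset `t_μ W ∈ W_ext / W`. -/
def coset {n : ℕ} (μ : Weight n) : Set (ExtWeyl n) :=
  {x | ∃ w : Equiv.Perm (Fin (n + 1)), x = transl μ * ofFin w}

/-- `x` is the element of minimal `B`-twisted length in the coset of `μ`. -/
def IsMinRep {n : ℕ} (B : Set (AffineRoot n)) (μ : Weight n) (x : ExtWeyl n) : Prop :=
  x ∈ coset μ ∧ ∀ z ∈ coset μ, twistedLength B x ≤ twistedLength B z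

/-- The `B`-twisted Bruhat order on weights: comparison of the elements of minimal `B`-twisted
length in the two cosets. -/
def weightLE {n : ℕ} (B : Set (AffineRoot n)) (μ ν : Weight n) : Prop :=
  ∃ x z : ExtWeyl n, IsMinRep B μ x ∧ IsMinRep B ν z ∧ twistedLE B x z

/-- The strict `B`-twisted Bruhat order on weights. -/
def weightLT {n : ℕ} (B : Set (AffineRoot n)) (μ ν : Weight n) : Prop :=
  weightLE B μ ν ∧ μ ≠ ν

/-- The Bruhat order on weights (the untwisted case). -/
def bruhatLE {n : ℕ} (μ ν : Weight n) : Prop := weightLE ∅ μ ν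

/-- The strict Bruhat order on weights. -/
def bruhatLT {n : ℕ} (μ ν : Weight n) : Prop := weightLT ∅ μ ν

/-- The twisted Bruhat graph `Γ_X^m`: there is an arrow `μ → ν` if `ν = s_α μ` for some real
affine root `α` and `μ < ν` in the Bruhat order twisted by `N(y_m)`. -/
def twistedGraph {n : ℕ} [NeZero n] (m : ℕ) : Digraph (Weight n) where
  Adj μ ν := (∃ α : AffineRoot n, affRefl α • μ = ν) ∧ weightLT (inversions (wordPrefix m)) μ ν

/-- The arrows of `Γ_X^m` between weights that are `≤ lam` in the (untwisted) Bruhat order: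
the graph `Γ_lam^m`. -/
def twistedGraphBelow {n : ℕ} [NeZero n] (m : ℕ) (lam : Weight n) : Digraph (Weight n) where
  Adj μ ν := (twistedGraph m).Adj μ ν ∧ bruhatLE μ lam ∧ bruhatLE ν lam

/-- The arrows of `Γ_lam^m` directed to `μ`, each given by its source. (Two weights are joined by
at most one reflection, so an arrow to `μ` is determined by its source.) -/
def arrowsInto {n : ℕ} [NeZero n] (m : ℕ) (lam μ : Weight n) : Set (Weight n) :=
  {ν | (twistedGraphBelow m lam).Adj ν μ}

end AffineA

namespace AffineA

/-! Represent weights by integer vectors `v` with a fixed coordinate sum. The source of an arrow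
into `v` is `shift v p q e` with `e > 0`, for a unique triple `(p, q, e)`, so arrows can be counted
for each ordered pair `(p, q)` separately. Two conditions bound `e`. Since the twisted length is the
ordinary length after multiplication by `y⁻¹` (`twistedLength_inversions`), the twisted order
compares `v` with a reflection of it according to the sign of `y⁻¹ • α`. By
`wordPrefix_inv_smul_isPos_iff` this gives `e ≤ negLevel m p q - v p + v q`. Below a dominant weight
the Bruhat order is majorization, tested by the functions `hinge` (`bruhatLE_iff_hinge_le`), and
this gives the bound by the dominant weight. Let `l` be the last index and `j = m % n`. Then `t` is
a reflection in the plane of `l` and `j`, and it moves `v` to `shift v l j d`. Its root is simple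
for the twisted positive system, so `t` permutes the other twisted-positive roots. Without the
majorization bound it therefore exchanges, for each third index `i`, the counts for `(j, i)` and
`(l, i)`, and those for `(i, j)` and `(i, l)`. On the line through `v` and `t v`, the `d - 1`
interior points send arrows to both ends, and the arrow from `v` to `t v` is the one extra arrow.
The majorization bound can only bite for `p = l`, because otherwise the source is majorized by the
target. For pairs `(l, i)` it removes equally many lengths at `v` and at `t v`, by the bijection `e
↦ e - d` (`card_arrowLengths_add`). -/

variable {n : ℕ}

/-! ### Weights in coordinates and affine reflections. -/

@[simp] lemma pair_mk (i j : Fin (n + 1)) (v : Fin (n + 1) → ℤ) :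
    pair i j (QuotientAddGroup.mk v : Weight n) = v i - v j := rfl

lemma weylAct_mk (w : Equiv.Perm (Fin (n + 1))) (v : Fin (n + 1) → ℤ) :
    weylAct w (QuotientAddGroup.mk v : Weight n) = QuotientAddGroup.mk (v ∘ w.symm) := rfl

lemma pair_root (p q i j : Fin (n + 1)) :
    pair p q (root i j) = (if p = i then 1 else 0) - (if p = j then 1 else 0)
      - ((if q = i then 1 else 0) - (if q = j then 1 else 0)) := by
  simp only [root, pair_mk, Pi.sub_apply, Pi.single_apply]

lemma root_swap (i j : Fin (n + 1)) : root j i = -root i j := by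
  unfold root
  rw [← QuotientAddGroup.mk_neg, neg_sub]

lemma weylAct_root (w : Equiv.Perm (Fin (n + 1))) (i j : Fin (n + 1)) :
    weylAct w (root i j) = root (w i) (w j) := by
  unfold root
  rw [weylAct_mk]
  congr 1
  funext k
  simp [Pi.single_apply, Equiv.symm_apply_eq]

lemma weylAct_swap (i j : Fin (n + 1)) (μ : Weight n) :
    weylAct (Equiv.swap i j) μ = μ - pair i j μ • root i j := by
  induction μ using QuotientAddGroup.induction_on with
  | H v =>
    rw [weylAct_mk, pair_mk, root, ← QuotientAddGroup.mk_zsmul, ← QuotientAddGroup.mk_sub]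
    congr 1
    funext k
    simp only [Function.comp, Equiv.symm_swap, Equiv.swap_apply_def, Pi.sub_apply, Pi.smul_apply,
      Pi.single_apply, smul_eq_mul]
    split_ifs <;> subst_vars <;> simp_all

lemma smul_weight (x : ExtWeyl n) (μ : Weight n) :
    x • μ = x.left.toAdd + weylAct x.right μ := rfl

lemma smul_root_i (x : ExtWeyl n) (α : AffineRoot n) : (x • α).i = x.right α.i := rfl
lemma smul_root_j (x : ExtWeyl n) (α : AffineRoot n) : (x • α).j = x.right α.j := rfl
lemma smul_root_level (x : ExtWeyl n) (α : AffineRoot n) :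
    (x • α).level = α.level + pair (x.right α.i) (x.right α.j) x.left.toAdd := rfl

lemma affRefl_left (α : AffineRoot n) :
    (affRefl α).left.toAdd = α.level • root α.i α.j := by
  change α.level • root α.i α.j + weylAct 1 0 = _
  simp

lemma affRefl_right (α : AffineRoot n) : (affRefl α).right = Equiv.swap α.i α.j := by
  change 1 * Equiv.swap α.i α.j = _
  simp

lemma affRefl_smul_weight (α : AffineRoot n) (μ : Weight n) :
    affRefl α • μ = μ + (α.level - pair α.i α.j μ) • root α.i α.j := by
  rw [smul_weight, affRefl_left, affRefl_right, weylAct_swap, sub_smul]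
  abel

lemma ext_of_left_right {x z : ExtWeyl n} (h : x.left.toAdd = z.left.toAdd)
    (h' : x.right = z.right) : x = z :=
  SemidirectProduct.ext (Multiplicative.toAdd.injective h) h'

lemma mul_left_toAdd (x z : ExtWeyl n) :
    (x * z).left.toAdd = x.left.toAdd + weylAct x.right z.left.toAdd := rfl

lemma affRefl_mul_self (α : AffineRoot n) : affRefl α * affRefl α = 1 := by
  refine ext_of_left_right ?_ ?_
  · rw [mul_left_toAdd, affRefl_left, affRefl_right, map_zsmul, weylAct_root,
      Equiv.swap_apply_left, Equiv.swap_apply_right, root_swap]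
    simp
  · rw [SemidirectProduct.mul_right, affRefl_right]
    simp

lemma affRefl_inv (α : AffineRoot n) : (affRefl α)⁻¹ = affRefl α :=
  inv_eq_of_mul_eq_one_right (affRefl_mul_self α)

lemma mul_affRefl (x : ExtWeyl n) (α : AffineRoot n) :
    x * affRefl α = affRefl (x • α) * x := by
  refine ext_of_left_right ?_ ?_
  · rw [mul_left_toAdd, mul_left_toAdd, affRefl_left, affRefl_left, affRefl_right, weylAct_swap,
      map_zsmul, weylAct_root, smul_root_i, smul_root_j, smul_root_level, add_zsmul]
    abel
  · rw [SemidirectProduct.mul_right, SemidirectProduct.mul_right, affRefl_right, affRefl_right,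
      smul_root_i, smul_root_j, Equiv.mul_swap_eq_swap_mul]

/-! ### Opposite roots, heights and positivity. -/

/-- The opposite affine root. -/
def AffineRoot.opp (α : AffineRoot n) : AffineRoot n := ⟨α.j, α.i, -α.level, α.ne.symm⟩

lemma opp_opp (α : AffineRoot n) : α.opp.opp = α := by
  simp [AffineRoot.opp]

lemma smul_opp (x : ExtWeyl n) (α : AffineRoot n) : x • α.opp = (x • α).opp := by
  refine AffineRoot.ext rfl rfl ?_
  change -α.level + pair _ _ _ = -(α.level + pair _ _ _)
  induction h : x.left.toAdd using QuotientAddGroup.induction_on with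
  | H v => simp [AffineRoot.opp]; ring

lemma affRefl_opp (α : AffineRoot n) : affRefl α.opp = affRefl α := by
  refine ext_of_left_right ?_ ?_
  · rw [affRefl_left, affRefl_left]
    simp [AffineRoot.opp, root_swap α.i α.j]
  · rw [affRefl_right, affRefl_right]
    exact Equiv.swap_comm _ _

lemma affRefl_smul_self (α : AffineRoot n) : affRefl α • α = α.opp := by
  have := α.ne
  have := α.ne.symm
  refine AffineRoot.ext ?_ ?_ ?_
  · rw [smul_root_i, affRefl_right]; simp [AffineRoot.opp]
  · rw [smul_root_j, affRefl_right]; simp [AffineRoot.opp]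
  · rw [smul_root_level, affRefl_right, affRefl_left, map_zsmul, pair_root]
    simp [AffineRoot.opp, *]
    ring

/-- The height of an affine root. -/
def height (α : AffineRoot n) : ℤ := (n + 1) * α.level + (α.j : ℕ) - (α.i : ℕ)

lemma isPos_iff_height (α : AffineRoot n) : α.IsPos ↔ 0 < height α := by
  have hi := α.i.isLt
  have hj := α.j.isLt
  unfold AffineRoot.IsPos height
  rw [Fin.lt_def]
  constructor
  · rintro (h | ⟨h, h'⟩)
    · nlinarith
    · rw [h]; omega
  · intro h
    rcases lt_trichotomy α.level 0 with h0 | h0 | h0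
    · exfalso; nlinarith
    · rw [h0] at h; right; omega
    · left; exact h0

lemma height_opp (α : AffineRoot n) : height α.opp = -height α := by
  simp only [height, AffineRoot.opp]; ring

lemma height_ne_zero (α : AffineRoot n) : height α ≠ 0 := by
  have hi := α.i.isLt
  have hj := α.j.isLt
  have hne : (α.i : ℕ) ≠ α.j := fun h => α.ne (Fin.ext h)
  intro h
  unfold height at h
  rcases lt_trichotomy α.level 0 with h0 | h0 | h0
  · nlinarith
  · rw [h0] at h; omega
  · nlinarith

lemma isPos_opp (α : AffineRoot n) : α.opp.IsPos ↔ ¬ α.IsPos := by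
  have := height_ne_zero α
  rw [isPos_iff_height, isPos_iff_height, height_opp]
  omega

/-- The pairing of the finite parts of two affine roots. -/
def rootPairing (γ α : AffineRoot n) : ℤ :=
  (if γ.i = α.i then 1 else 0) - (if γ.i = α.j then 1 else 0)
    - ((if γ.j = α.i then 1 else 0) - (if γ.j = α.j then 1 else 0))

/-- Height and the action of `x` are linear on the span of the affine roots, and the reflection
subtracts `rootPairing γ α` times `α` from `γ`. -/
lemma height_smul_affRefl (x : ExtWeyl n) (α γ : AffineRoot n) :
    height (x • affRefl α • γ) = height (x • γ) - rootPairing γ α * height (x • α) := by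
  have h1 := α.ne
  have h2 := α.ne.symm
  simp only [height, smul_root_i, smul_root_j, smul_root_level, affRefl_right, affRefl_left,
    map_zsmul, pair_root, rootPairing]
  induction x.left.toAdd using QuotientAddGroup.induction_on with
  | H v =>
    simp only [pair_mk, smul_eq_mul]
    obtain ⟨p, q, k, hpq⟩ := γ
    obtain ⟨i, j, l, hij⟩ := α
    simp only at *
    by_cases a : p = i <;> by_cases b : p = j <;> by_cases c : q = i <;> by_cases d : q = j <;>
      subst_vars <;>
      simp_all [Equiv.swap_apply_of_ne_of_ne] <;> ring

/-! ### Inversion sets, length and twisted length. -/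

lemma inversions_finite (w : ExtWeyl n) : (inversions w).Finite := by
  let f : AffineRoot n → Fin (n + 1) × Fin (n + 1) × ℤ := fun α => (α.i, α.j, α.level)
  have hf : Function.Injective f := by
    intro α β h
    simp only [f, Prod.mk.injEq] at h
    exact AffineRoot.ext h.1 h.2.1 h.2.2
  let c : Fin (n + 1) → Fin (n + 1) → ℤ := fun i j =>
    -pair (w⁻¹.right i) (w⁻¹.right j) w⁻¹.left.toAdd
  have hfin : (⋃ i, ⋃ j, (fun k : ℤ => (i, j, k)) '' Set.Icc 0 (c i j)).Finite :=
    Set.finite_iUnion fun i => Set.finite_iUnion fun j => (Set.finite_Icc _ _).image _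
  refine (hfin.preimage hf.injOn).subset ?_
  rintro α ⟨h1, h2⟩
  simp only [Set.mem_preimage, Set.mem_iUnion, Set.mem_image]
  refine ⟨α.i, α.j, α.level, ⟨?_, ?_⟩, rfl⟩
  · rcases h1 with h | h <;> omega
  · by_contra h
    apply h2
    left
    rw [smul_root_level]
    simp only [c] at h
    omega

lemma inversions_one : inversions (1 : ExtWeyl n) = ∅ := by
  ext α
  simp [inversions]

/-- The inversions of `affRefl α * x` inject into those of `x` other than `α`: reflect `γ` if the
result is still positive, and keep `γ` otherwise. -/
lemma length_affRefl_mul_lt (x : ExtWeyl n) (α : AffineRoot n) (h : α.IsPos)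
    (hx : ¬ (x⁻¹ • α).IsPos) : length (affRefl α * x) < length x := by
  classical
  have hα := (isPos_iff_height α).1 h
  have hxα : height (x⁻¹ • α) < 0 := by
    have := height_ne_zero (x⁻¹ • α)
    rw [isPos_iff_height] at hx
    omega
  let φ : AffineRoot n → AffineRoot n := fun γ =>
    if (affRefl α • γ).IsPos then affRefl α • γ else γ
  have hinv : (affRefl α * x)⁻¹ = x⁻¹ * affRefl α := by rw [mul_inv_rev, affRefl_inv]
  have hss : ∀ γ : AffineRoot n, affRefl α • affRefl α • γ = γ := fun γ => by
    rw [← mul_smul, affRefl_mul_self, one_smul]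
  have hsα : ¬ (affRefl α • α).IsPos := by
    rw [affRefl_smul_self, isPos_opp, not_not]; exact h
  have hmem : α ∈ inversions x := ⟨h, hx⟩
  have hmaps : ∀ γ ∈ inversions (affRefl α * x), φ γ ∈ inversions x \ {α} := by
    rintro γ ⟨h1, h2⟩
    rw [hinv, mul_smul] at h2
    simp only [φ]
    split_ifs with h3
    · refine ⟨⟨h3, h2⟩, ?_⟩
      rintro (h4 : _ = α)
      rw [← hss γ, h4] at h1
      exact hsα h1
    · refine ⟨⟨h1, ?_⟩, ?_⟩
      -- As `γ` is positive and its reflection is not, the pairing is positive. Since `x⁻¹ • α` is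
      -- negative, `x⁻¹ • γ` then has smaller height than the image of the reflected root, which is
      -- already negative.
      · have e1 := height_smul_affRefl 1 α γ
        have e2 := height_smul_affRefl x⁻¹ α γ
        simp only [one_smul] at e1
        rw [isPos_iff_height] at *
        have hc : 0 < rootPairing γ α := by
          by_contra hc
          have : rootPairing γ α * height α ≤ 0 :=
            mul_nonpos_of_nonpos_of_nonneg (by omega) hα.le
          omega
        have : rootPairing γ α * height (x⁻¹ • α) < 0 := mul_neg_of_pos_of_neg hc hxα
        omega
      · rintro (h4 : γ = α)
        subst h4
        rw [affRefl_smul_self, smul_opp, isPos_opp, not_not] at h2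
        exact hx h2
  have hinj : Set.InjOn φ (inversions (affRefl α * x)) := by
    rintro γ ⟨h1, -⟩ γ' ⟨h1', -⟩ he
    simp only [φ] at he
    split_ifs at he with h3 h4 h4
    · rw [← hss γ, he, hss]
    · rw [← he, hss] at h4; exact absurd h1 h4
    · rw [he, hss] at h3; exact absurd h1' h3
    · exact he
  have h1 := Set.ncard_le_ncard_of_injOn φ hmaps hinj ((inversions_finite x).subset Set.sdiff_subset)
  have h2 := Set.ncard_sdiff_singleton_lt_of_mem hmem (inversions_finite x)
  exact h1.trans_lt h2

/-- Up to sign, `y⁻¹` carries the symmetric difference of the two inversion sets onto the inversion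
set of `y⁻¹ * w`. Thus the twisted order is the ordinary Bruhat order transported by `y`. -/
lemma twistedLength_inversions (y w : ExtWeyl n) :
    twistedLength (inversions y) w = length (y⁻¹ * w) := by
  classical
  set A := inversions w
  set B := inversions y
  have hA : A.Finite := inversions_finite w
  have hB : B.Finite := inversions_finite y
  let φ : AffineRoot n → AffineRoot n := fun γ => if γ ∈ A then y⁻¹ • γ else y⁻¹ • γ.opp
  have hsm : ∀ γ : AffineRoot n, (y⁻¹ * w)⁻¹ • γ = w⁻¹ • y • γ := fun γ => by
    rw [mul_inv_rev, inv_inv, mul_smul]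
  have himg : inversions (y⁻¹ * w) = φ '' ((A \ B) ∪ (B \ A)) := by
    ext γ
    constructor
    · rintro ⟨h1, h2⟩
      rw [hsm] at h2
      by_cases h3 : (y • γ).IsPos
      · have hm : y • γ ∈ A := ⟨h3, h2⟩
        refine ⟨y • γ, Or.inl ⟨hm, ?_⟩, ?_⟩
        · rintro ⟨-, h4⟩
          rw [inv_smul_smul] at h4
          exact h4 h1
        · simp only [φ, if_pos hm, inv_smul_smul]
      · have hm : (y • γ).opp ∉ A := by
          rintro ⟨-, h4⟩
          rw [smul_opp, isPos_opp, not_not] at h4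
          exact h2 h4
        refine ⟨(y • γ).opp, Or.inr ⟨⟨(isPos_opp _).2 h3, ?_⟩, hm⟩, ?_⟩
        · rw [smul_opp, inv_smul_smul, isPos_opp, not_not]
          exact h1
        · simp only [φ, if_neg hm, opp_opp, inv_smul_smul]
    · rintro ⟨γ, ⟨h1, h2⟩ | ⟨h1, h2⟩, rfl⟩
      · simp only [φ, if_pos h1]
        refine ⟨?_, ?_⟩
        · by_contra h3
          exact h2 ⟨h1.1, h3⟩
        · rw [hsm, smul_inv_smul]
          exact h1.2
      · simp only [φ, if_neg h2]
        refine ⟨?_, ?_⟩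
        · rw [smul_opp, isPos_opp]
          exact h1.2
        · rw [hsm, smul_inv_smul, smul_opp, isPos_opp, not_not]
          by_contra h3
          exact h2 ⟨h1.1, h3⟩
  have hinj : Set.InjOn φ ((A \ B) ∪ (B \ A)) := by
    have hpos : ∀ γ ∈ (A \ B) ∪ (B \ A), γ.IsPos := by
      rintro γ (h | h)
      exacts [h.1.1, h.1.1]
    intro γ h γ' h' he
    have p := hpos γ h
    have p' := hpos γ' h'
    simp only [φ] at he
    split_ifs at he
    · exact smul_left_cancel _ he
    · rw [smul_left_cancel _ he, isPos_opp] at p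
      exact absurd p' p
    · rw [← smul_left_cancel _ he, isPos_opp] at p'
      exact absurd p p'
    · rw [← opp_opp γ, smul_left_cancel _ he, opp_opp]
  have hcard : length (y⁻¹ * w) = (A \ B).ncard + (B \ A).ncard := by
    rw [length, himg, hinj.ncard_image, Set.ncard_union_eq _ hA.sdiff hB.sdiff]
    exact Set.disjoint_left.2 fun γ h h' => h.2 h'.1
  have e1 := Set.ncard_inter_add_ncard_sdiff_eq_ncard A B hA
  have e2 := Set.ncard_inter_add_ncard_sdiff_eq_ncard B A hB
  rw [Set.inter_comm] at e2
  rw [hcard, twistedLength]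
  change (A.ncard : ℤ) - 2 * ((A ∩ B).ncard : ℤ) + (B.ncard : ℤ) = _
  push_cast
  omega

lemma length_lt_affRefl_mul (x : ExtWeyl n) (α : AffineRoot n) (h : α.IsPos)
    (hx : (x⁻¹ • α).IsPos) : length x < length (affRefl α * x) := by
  have := length_affRefl_mul_lt (affRefl α * x) α h (by
    rw [mul_inv_rev, affRefl_inv, mul_smul, affRefl_smul_self, smul_opp, isPos_opp, not_not]
    exact hx)
  rwa [← mul_assoc, affRefl_mul_self, one_mul] at this

lemma twistedLength_lt_affRefl_mul (y x : ExtWeyl n) (α : AffineRoot n) (h : (y⁻¹ • α).IsPos)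
    (hx : (x⁻¹ • α).IsPos) :
    twistedLength (inversions y) x < twistedLength (inversions y) (affRefl α * x) := by
  rw [twistedLength_inversions, twistedLength_inversions, ← mul_assoc, mul_affRefl, mul_assoc]
  have := length_lt_affRefl_mul (y⁻¹ * x) (y⁻¹ • α) h (by
    rwa [mul_inv_rev, inv_inv, mul_smul, smul_inv_smul])
  exact_mod_cast this

lemma twistedLength_affRefl_mul_lt (y x : ExtWeyl n) (α : AffineRoot n) (h : (y⁻¹ • α).IsPos)
    (hx : ¬ (x⁻¹ • α).IsPos) :
    twistedLength (inversions y) (affRefl α * x) < twistedLength (inversions y) x := by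
  have := twistedLength_lt_affRefl_mul y (affRefl α * x) α h (by
    rw [mul_inv_rev, affRefl_inv, mul_smul, affRefl_smul_self, smul_opp, isPos_opp]
    exact hx)
  rwa [← mul_assoc, affRefl_mul_self, one_mul] at this

lemma exists_root_of_twistedLength_lt (y x : ExtWeyl n) (α : AffineRoot n)
    (h : twistedLength (inversions y) x < twistedLength (inversions y) (affRefl α * x)) :
    ∃ β : AffineRoot n, affRefl β = affRefl α ∧ (y⁻¹ • β).IsPos ∧ (x⁻¹ • β).IsPos := by
  by_cases h1 : (y⁻¹ • α).IsPos
  · refine ⟨α, rfl, h1, ?_⟩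
    by_contra h2
    exact absurd h (twistedLength_affRefl_mul_lt y x α h1 h2).not_gt
  · have h1' : (y⁻¹ • α.opp).IsPos := by rwa [smul_opp, isPos_opp]
    refine ⟨α.opp, affRefl_opp α, h1', ?_⟩
    by_contra h2
    have := twistedLength_affRefl_mul_lt y x α.opp h1' h2
    rw [affRefl_opp] at this
    exact absurd h this.not_gt

/-! ### Minimal coset representatives and the twisted order on weights. -/

lemma mem_coset {μ : Weight n} {x : ExtWeyl n} : x ∈ coset μ ↔ x.left.toAdd = μ := by
  constructor
  · rintro ⟨w, rfl⟩
    change μ + weylAct 1 0 = μ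
    simp
  · intro h
    refine ⟨x.right, ext_of_left_right ?_ ?_⟩
    · change _ = μ + weylAct 1 0
      simpa using h
    · change _ = 1 * x.right
      simp

/-- The finite positive root `ε_i - ε_j` (`i < j`), as an affine root. -/
def finRoot {i j : Fin (n + 1)} (h : i < j) : AffineRoot n := ⟨i, j, 0, h.ne⟩

/-- `z` sends the finite positive roots to roots that are positive for `y`. -/
def IsGood (y z : ExtWeyl n) : Prop :=
  ∀ (i j : Fin (n + 1)) (h : i < j), (y⁻¹ • z • finRoot h).IsPos

lemma coset_mul_affRefl_finRoot {μ : Weight n} {x : ExtWeyl n} (hx : x ∈ coset μ)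
    {i j : Fin (n + 1)} (h : i < j) : x * affRefl (finRoot h) ∈ coset μ := by
  rw [mem_coset] at *
  rw [mul_left_toAdd, affRefl_left, hx]
  simp [finRoot]

lemma exists_twistedLength_gt_of_not_isGood {y z : ExtWeyl n} {μ : Weight n} (hz : z ∈ coset μ)
    (h : ¬ IsGood y z) : ∃ x ∈ coset μ, ∃ α : AffineRoot n, z = affRefl α * x ∧
      twistedLength (inversions y) x < twistedLength (inversions y) z := by
  simp only [IsGood, not_forall] at h
  obtain ⟨i, j, hij, h⟩ := h
  refine ⟨z * affRefl (finRoot hij), coset_mul_affRefl_finRoot hz hij, z • finRoot hij, ?_, ?_⟩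
  · rw [mul_affRefl, ← mul_assoc, affRefl_mul_self, one_mul]
  · rw [mul_affRefl, ← affRefl_opp]
    refine twistedLength_affRefl_mul_lt y z _ ?_ ?_
    · rwa [smul_opp, isPos_opp]
    · rw [smul_opp, isPos_opp, not_not, inv_smul_smul]
      exact Or.inr ⟨rfl, hij⟩

lemma twistedLength_inversions_nonneg (y x : ExtWeyl n) :
    0 ≤ twistedLength (inversions y) x := by
  rw [twistedLength_inversions]
  positivity

lemma exists_isGood_twistedLE (y : ExtWeyl n) {μ : Weight n} (x : ExtWeyl n) (hx : x ∈ coset μ) :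
    ∃ z ∈ coset μ, IsGood y z ∧ twistedLE (inversions y) z x := by
  induction h : (twistedLength (inversions y) x).toNat using Nat.strong_induction_on
    generalizing x with
  | h k ih =>
    by_cases hg : IsGood y x
    · exact ⟨x, hx, hg, Relation.ReflTransGen.refl⟩
    · obtain ⟨x', hx', α, hα, hlt⟩ := exists_twistedLength_gt_of_not_isGood hx hg
      have := twistedLength_inversions_nonneg y x'
      obtain ⟨z, hz, hzg, hle⟩ := ih _ (by omega) x' hx' rfl
      exact ⟨z, hz, hzg, hle.tail ⟨α, hα, hlt⟩⟩

/-- The permutation by which the two linear parts differ is strictly increasing, hence the identity.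
-/
lemma IsGood.unique {y z z' : ExtWeyl n} {μ : Weight n} (hz : z ∈ coset μ) (hz' : z' ∈ coset μ)
    (h : IsGood y z) (h' : IsGood y z') : z = z' := by
  rw [mem_coset] at hz hz'
  have key : ∀ i j : Fin (n + 1), i < j → z.right.symm (z'.right i) < z.right.symm (z'.right j) := by
    intro i j hij
    by_contra hn
    have hne : z.right.symm (z'.right i) ≠ z.right.symm (z'.right j) := by
      simpa using hij.ne
    have hlt := lt_of_le_of_ne (not_lt.1 hn) hne.symm
    have h1 := h _ _ hlt
    have h2 := h' i j hij
    have e : z • finRoot hlt = (z' • finRoot hij).opp := by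
      rw [← smul_opp]
      refine AffineRoot.ext ?_ ?_ ?_
      · simp [smul_root_i, finRoot, AffineRoot.opp]
      · simp [smul_root_j, finRoot, AffineRoot.opp]
      · simp [smul_root_level, finRoot, AffineRoot.opp, hz, hz']
    rw [e, smul_opp, isPos_opp] at h1
    exact h1 h2
  have hmono : StrictMono (fun i => z.right.symm (z'.right i)) := fun i j => key i j
  have hid : (fun i => z.right.symm (z'.right i)) = id := by
    refine (StrictMono.range_inj hmono strictMono_id).1 ?_
    rw [Set.range_id]
    exact (z.right.symm.surjective.comp z'.right.surjective).range_eq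
  refine ext_of_left_right (hz.trans hz'.symm) ?_
  ext i
  have := congrFun hid i
  simp only [id, Equiv.symm_apply_eq] at this
  rw [this]

lemma twistedLE.length_le {B : Set (AffineRoot n)} {x z : ExtWeyl n} (h : twistedLE B x z) :
    x = z ∨ twistedLength B x < twistedLength B z := by
  induction h with
  | refl => exact Or.inl rfl
  | tail _ h2 ih =>
    obtain ⟨-, -, h3⟩ := h2
    rcases ih with rfl | ih
    · exact Or.inr h3
    · exact Or.inr (ih.trans h3)

lemma isMinRep_iff {y z : ExtWeyl n} {μ : Weight n} :
    IsMinRep (inversions y) μ z ↔ z ∈ coset μ ∧ IsGood y z := by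
  constructor
  · rintro ⟨h1, h2⟩
    refine ⟨h1, ?_⟩
    by_contra hg
    obtain ⟨x, hx, -, -, hlt⟩ := exists_twistedLength_gt_of_not_isGood h1 hg
    exact absurd (h2 x hx) hlt.not_ge
  · rintro ⟨h1, h2⟩
    refine ⟨h1, fun x hx => ?_⟩
    obtain ⟨z', hz', hg, hle⟩ := exists_isGood_twistedLE y x hx
    rw [← h2.unique h1 hz' hg] at hle
    rcases hle.length_le with rfl | h
    · exact le_rfl
    · exact h.le

lemma exists_isMinRep (y : ExtWeyl n) (μ : Weight n) : ∃ z, IsMinRep (inversions y) μ z := by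
  obtain ⟨z, hz, hg, -⟩ := exists_isGood_twistedLE y (transl μ) (μ := μ) (mem_coset.2 rfl)
  exact ⟨z, isMinRep_iff.2 ⟨hz, hg⟩⟩

lemma IsMinRep.unique {y z z' : ExtWeyl n} {μ : Weight n} (h : IsMinRep (inversions y) μ z)
    (h' : IsMinRep (inversions y) μ z') : z = z' := by
  rw [isMinRep_iff] at h h'
  exact h.2.unique h.1 h'.1 h'.2

lemma IsMinRep.twistedLE {y z x : ExtWeyl n} {μ : Weight n} (h : IsMinRep (inversions y) μ z)
    (hx : x ∈ coset μ) : twistedLE (inversions y) z x := by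
  obtain ⟨z', hz', hg, hle⟩ := exists_isGood_twistedLE y x hx
  rwa [h.unique (isMinRep_iff.2 ⟨hz', hg⟩)]

lemma weightLE_refl (y : ExtWeyl n) (μ : Weight n) : weightLE (inversions y) μ μ := by
  obtain ⟨z, hz⟩ := exists_isMinRep y μ
  exact ⟨z, z, hz, hz, Relation.ReflTransGen.refl⟩

lemma weightLE_trans {y : ExtWeyl n} {μ ν ξ : Weight n} (h : weightLE (inversions y) μ ν)
    (h' : weightLE (inversions y) ν ξ) : weightLE (inversions y) μ ξ := by
  obtain ⟨x, z, hx, hz, h1⟩ := h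
  obtain ⟨z', u, hz', hu, h2⟩ := h'
  rw [hz'.unique hz] at h2
  exact ⟨x, u, hx, hu, Relation.ReflTransGen.trans h1 h2⟩

lemma weightLE_antisymm {y : ExtWeyl n} {μ ν : Weight n} (h : weightLE (inversions y) μ ν)
    (h' : weightLE (inversions y) ν μ) : μ = ν := by
  obtain ⟨x, z, hx, hz, h1⟩ := h
  obtain ⟨z', x', hz', hx', h2⟩ := h'
  rw [hz'.unique hz, hx'.unique hx] at h2
  have hxz : x = z := by
    rcases h1.length_le with h1 | h1
    · exact h1
    · rcases h2.length_le with h2 | h2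
      · exact h2.symm
      · exact absurd h1 h2.not_gt
  rw [← mem_coset.1 hx.1, ← mem_coset.1 hz.1, hxz]

lemma affRefl_mul_mem_coset {μ : Weight n} {x : ExtWeyl n} (hx : x ∈ coset μ) (α : AffineRoot n) :
    affRefl α * x ∈ coset (affRefl α • μ) := by
  rw [mem_coset] at *
  rw [mul_left_toAdd, hx, smul_weight]

lemma inv_smul_level {μ : Weight n} {x : ExtWeyl n} (hx : x ∈ coset μ) (α : AffineRoot n) :
    (x⁻¹ • α).level = α.level - pair α.i α.j μ := by
  have h : (x • x⁻¹ • α).level = α.level := by rw [smul_inv_smul]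
  have hi : (x • x⁻¹ • α).i = α.i := by rw [smul_inv_smul]
  have hj : (x • x⁻¹ • α).j = α.j := by rw [smul_inv_smul]
  rw [smul_root_level, mem_coset.1 hx, ← smul_root_i, ← smul_root_j, hi, hj] at h
  omega

/-- Reflecting the minimal representative of the upper weight gives a smaller element in the coset
of `μ`, and the minimal representative of `μ` lies below that whole coset. -/
lemma weightLE_affRefl (y : ExtWeyl n) (α : AffineRoot n) (μ : Weight n) (h : (y⁻¹ • α).IsPos)
    (hμ : pair α.i α.j μ < α.level) : weightLE (inversions y) μ (affRefl α • μ) := by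
  obtain ⟨z, hz⟩ := exists_isMinRep y (affRefl α • μ)
  obtain ⟨x, hx⟩ := exists_isMinRep y μ
  have hmem : affRefl α * z ∈ coset μ := by
    have := affRefl_mul_mem_coset hz.1 α
    rwa [← mul_smul, affRefl_mul_self, one_smul] at this
  refine ⟨x, z, hx, hz, (hx.twistedLE hmem).tail ⟨α, ?_, ?_⟩⟩
  · rw [← mul_assoc, affRefl_mul_self, one_mul]
  · have := twistedLength_lt_affRefl_mul y (affRefl α * z) α h
      (Or.inl (by rw [inv_smul_level hmem]; omega))
    rwa [← mul_assoc, affRefl_mul_self, one_mul] at this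

/-- A weight and its reflection are always comparable. If `y⁻¹ • α` is negative, the same argument
with the opposite root reverses the comparison. -/
lemma weightLT_affRefl_iff (y : ExtWeyl n) (α : AffineRoot n) (μ : Weight n)
    (hμ : pair α.i α.j μ < α.level) (hne : μ ≠ affRefl α • μ) :
    weightLT (inversions y) μ (affRefl α • μ) ↔ (y⁻¹ • α).IsPos := by
  constructor
  · rintro ⟨h, -⟩
    by_contra hn
    have hn' : (y⁻¹ • α.opp).IsPos := by rwa [smul_opp, isPos_opp]
    have hlt : pair α.opp.i α.opp.j (affRefl α • μ) < α.opp.level := by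
      change pair α.j α.i _ < -α.level
      rw [affRefl_smul_weight, map_add, map_zsmul, pair_root]
      have h1 := α.ne
      have h2 := α.ne.symm
      have h3 : pair α.j α.i μ = -pair α.i α.j μ := by
        induction μ using QuotientAddGroup.induction_on with
        | H v => simp
      simp only [h3, if_neg h1, if_neg h2, if_true, smul_eq_mul]
      omega
    have := weightLE_affRefl y α.opp _ hn' hlt
    rw [affRefl_opp, ← mul_smul, affRefl_mul_self, one_smul] at this
    exact hne (weightLE_antisymm h this)
  · exact fun h => ⟨weightLE_affRefl y α μ h hμ, hne⟩

lemma bruhatLE_eq : (bruhatLE : Weight n → Weight n → Prop) = weightLE (inversions 1) := by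
  rw [inversions_one]
  rfl

/-! ### The Bruhat order below a dominant weight is majorization. -/

/-- The hinge sum `∑ (v_i - c)⁺`. -/
def hinge (v : Fin (n + 1) → ℤ) (c : ℤ) : ℤ := ∑ i, max (v i - c) 0

/-- The vector `v + e (ε_p - ε_q)`. -/
def shift (v : Fin (n + 1) → ℤ) (p q : Fin (n + 1)) (e : ℤ) : Fin (n + 1) → ℤ :=
  fun k => v k + (if k = p then e else 0) - (if k = q then e else 0)

lemma mk_shift (v : Fin (n + 1) → ℤ) (p q : Fin (n + 1)) (e : ℤ) :
    (QuotientAddGroup.mk (shift v p q e) : Weight n) = QuotientAddGroup.mk v + e • root p q := by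
  rw [root, ← QuotientAddGroup.mk_zsmul, ← QuotientAddGroup.mk_add]
  congr 1
  funext k
  simp only [shift, Pi.add_apply, Pi.smul_apply, Pi.sub_apply, Pi.single_apply, smul_eq_mul]
  split_ifs <;> ring

lemma affRefl_smul_mk (α : AffineRoot n) (v : Fin (n + 1) → ℤ) :
    affRefl α • (QuotientAddGroup.mk v : Weight n) =
      QuotientAddGroup.mk (shift v α.i α.j (α.level - (v α.i - v α.j))) := by
  rw [affRefl_smul_weight, mk_shift, pair_mk]

lemma shift_neg (v : Fin (n + 1) → ℤ) (p q : Fin (n + 1)) (e : ℤ) :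
    shift v p q (-e) = shift v q p e := by
  funext k
  simp only [shift]
  split_ifs <;> ring

lemma sum_shift (v : Fin (n + 1) → ℤ) (p q : Fin (n + 1)) (e : ℤ) :
    ∑ k, shift v p q e k = ∑ k, v k := by
  simp [shift, Finset.sum_add_distrib, Finset.sum_sub_distrib]

lemma sum_sub_of_eq_off {ι : Type*} [Fintype ι] [DecidableEq ι] (F G : ι → ℤ) (s : Finset ι)
    (h : ∀ k, k ∉ s → F k = G k) : ∑ k, F k - ∑ k, G k = ∑ k ∈ s, (F k - G k) := by
  rw [← Finset.sum_sub_distrib]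
  exact (Finset.sum_subset (Finset.subset_univ s) fun k _ hk => sub_eq_zero.2 (h k hk)).symm

lemma hinge_shift_sub (v : Fin (n + 1) → ℤ) {p q : Fin (n + 1)} (h : p ≠ q) (e c : ℤ) :
    hinge (shift v p q e) c - hinge v c =
      (max (v p + e - c) 0 - max (v p - c) 0) + (max (v q - e - c) 0 - max (v q - c) 0) := by
  rw [hinge, hinge, sum_sub_of_eq_off _ _ {p, q}, Finset.sum_pair h]
  · simp [shift, h, h.symm]
  · intro k hk
    simp only [Finset.mem_insert, Finset.mem_singleton, not_or] at hk
    simp [shift, hk]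

/-- Convexity: the coordinates at `p` and `q` are moved into the interval between their old values,
with the same sum. -/
lemma hinge_shift_le (v : Fin (n + 1) → ℤ) {p q : Fin (n + 1)} (h : p ≠ q) {e : ℤ} (he : 0 ≤ e)
    (hle : v p - v q + e ≤ 0) (c : ℤ) : hinge (shift v p q e) c ≤ hinge v c := by
  have := hinge_shift_sub v h e c
  omega

lemma hinge_comp_perm (v : Fin (n + 1) → ℤ) (σ : Equiv.Perm (Fin (n + 1))) (c : ℤ) :
    hinge (v ∘ σ) c = hinge v c :=
  Equiv.sum_comp σ fun i => max (v i - c) 0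

lemma eq_of_mk_eq_of_sum_eq {v w : Fin (n + 1) → ℤ}
    (h : (QuotientAddGroup.mk v : Weight n) = QuotientAddGroup.mk w)
    (hs : ∑ k, v k = ∑ k, w k) : v = w := by
  rw [QuotientAddGroup.eq] at h
  obtain ⟨k, hk⟩ := h
  have hw : ∀ i, w i = v i + k := fun i => by
    have := congrFun hk i
    simp at this
    omega
  have : ((n : ℤ) + 1) * k = 0 := by
    simp only [hw, Finset.sum_add_distrib] at hs
    simp at hs
    rcases hs with h | h
    · omega
    · rw [h, mul_zero]
  have hk0 : k = 0 := by
    rcases mul_eq_zero.1 this with h | h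
    · omega
    · exact h
  funext i
  rw [hw, hk0, add_zero]

/-- In a Bruhat step both `β` and `x⁻¹ • β` are positive, so both have level at least zero. These
two inequalities say that the lower vector arises from the upper one by drawing two coordinates
together. -/
lemma exists_lift_of_twistedLE {x z : ExtWeyl n} (h : twistedLE (inversions 1) x z)
    (f : Fin (n + 1) → ℤ) (hf : QuotientAddGroup.mk f = z.left.toAdd) :
    ∃ v : Fin (n + 1) → ℤ, QuotientAddGroup.mk v = x.left.toAdd ∧ ∑ k, v k = ∑ k, f k ∧
      ∀ c, hinge v c ≤ hinge f c := by
  induction h using Relation.ReflTransGen.head_induction_on with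
  | refl => exact ⟨f, hf, rfl, fun _ => le_rfl⟩
  | head h1 h0 ih =>
    clear h0
    rename_i x x₁
    obtain ⟨v, hv, hs, hh⟩ := ih
    obtain ⟨α, rfl, hlt⟩ := h1
    obtain ⟨β, hβ, h1, h2⟩ := exists_root_of_twistedLength_lt 1 x α hlt
    rw [← hβ] at hv
    have hxv : x.left.toAdd =
        QuotientAddGroup.mk (shift v β.i β.j (β.level - (v β.i - v β.j))) := by
      have := affRefl_mul_mem_coset (mem_coset.2 hv.symm) β
      rw [← mul_assoc, affRefl_mul_self, one_mul, mem_coset] at this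
      rw [this, affRefl_smul_mk]
    have hl : 0 ≤ β.level := by
      rw [inv_one, one_smul] at h1
      rcases h1 with h | h <;> omega
    have hl' : 0 ≤ (x⁻¹ • β).level := by
      rcases h2 with h | h <;> omega
    have hne := β.ne
    rw [inv_smul_level (mem_coset.2 hxv), pair_mk] at hl'
    refine ⟨_, hxv.symm, (sum_shift _ _ _ _).trans hs, fun c => le_trans ?_ (hh c)⟩
    rw [show β.level - (v β.i - v β.j) = -((v β.i - v β.j) - β.level) by ring, shift_neg]
    refine hinge_shift_le v hne.symm ?_ (by omega) c
    simp [shift, hne, hne.symm] at hl'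
    omega

lemma bruhatLE_shift (v : Fin (n + 1) → ℤ) {p q : Fin (n + 1)} (h : p ≠ q) {e : ℤ} (he : 0 < e)
    (hpos : 0 < v p - v q + e ∨ (v p - v q + e = 0 ∧ p < q)) :
    bruhatLE (QuotientAddGroup.mk v : Weight n) (QuotientAddGroup.mk (shift v p q e)) := by
  rw [bruhatLE_eq]
  have := weightLE_affRefl 1 ⟨p, q, v p - v q + e, h⟩ (QuotientAddGroup.mk v)
    (by rw [inv_one, one_smul]; exact hpos) (by simpa using he)
  rw [affRefl_smul_mk] at this
  simpa using this

lemma shift_eq_comp_swap (v : Fin (n + 1) → ℤ) (p q : Fin (n + 1)) :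
    shift v p q (v q - v p) = v ∘ Equiv.swap p q := by
  funext k
  simp only [shift, Function.comp, Equiv.swap_apply_def]
  split_ifs <;> subst_vars <;> ring

/-- Swapping two coordinates that are out of order goes up in the Bruhat order and lowers `∑ k * v
(σ k)`, so a minimizer among the reachable rearrangements is sorted. -/
lemma exists_antitone_bruhatLE (v : Fin (n + 1) → ℤ) :
    ∃ σ : Equiv.Perm (Fin (n + 1)), Antitone (v ∘ σ) ∧
      bruhatLE (QuotientAddGroup.mk v : Weight n) (QuotientAddGroup.mk (v ∘ σ)) := by
  classical
  let s : Finset (Equiv.Perm (Fin (n + 1))) := Finset.univ.filter fun σ =>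
    bruhatLE (QuotientAddGroup.mk v : Weight n) (QuotientAddGroup.mk (v ∘ σ))
  have hs : s.Nonempty := ⟨1, by
    simp only [s, Finset.mem_filter, Finset.mem_univ, true_and]
    rw [bruhatLE_eq]
    exact weightLE_refl 1 _⟩
  obtain ⟨σ, hσ, hmin⟩ := s.exists_min_image (fun σ => ∑ k : Fin (n + 1), ((k : ℕ) : ℤ) * v (σ k)) hs
  simp only [s, Finset.mem_filter, Finset.mem_univ, true_and] at hσ hmin
  refine ⟨σ, ?_, hσ⟩
  intro i j hij
  by_contra hlt
  rw [not_le] at hlt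
  have hij : i < j := lt_of_le_of_ne hij (by rintro rfl; exact lt_irrefl _ hlt)
  have hsw := bruhatLE_shift (v ∘ σ) hij.ne (e := (v ∘ σ) j - (v ∘ σ) i) (by omega)
    (Or.inr ⟨by ring, hij⟩)
  rw [shift_eq_comp_swap] at hsw
  have hle := hmin (σ * Equiv.swap i j) (by
    rw [bruhatLE_eq] at *
    exact weightLE_trans hσ hsw)
  have hdiff := sum_sub_of_eq_off (fun k : Fin (n + 1) => ((k : ℕ) : ℤ) * v ((σ * Equiv.swap i j) k))
    (fun k => ((k : ℕ) : ℤ) * v (σ k)) {i, j} (by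
      intro k hk
      simp only [Finset.mem_insert, Finset.mem_singleton, not_or] at hk
      simp only [Equiv.Perm.mul_apply, Equiv.swap_apply_of_ne_of_ne hk.1 hk.2])
  rw [Finset.sum_pair hij.ne] at hdiff
  simp only [Equiv.Perm.mul_apply, Equiv.swap_apply_left, Equiv.swap_apply_right] at hdiff
  simp only [Equiv.Perm.mul_apply] at hle
  simp only [Function.comp] at hlt
  have hij' : ((i : ℕ) : ℤ) < (j : ℕ) := by exact_mod_cast hij
  nlinarith

/-- The sum of the first `r` coordinates. -/
def prefixSum (v : Fin (n + 1) → ℤ) (r : ℕ) : ℤ := ∑ i ∈ Finset.univ.filter fun i : Fin (n + 1) => (i : ℕ) < r, v i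

lemma prefixSum_succ (v : Fin (n + 1) → ℤ) (p : Fin (n + 1)) :
    prefixSum v (p + 1) = prefixSum v p + v p := by
  have : (Finset.univ.filter fun i : Fin (n + 1) => (i : ℕ) < p + 1) =
      insert p (Finset.univ.filter fun i : Fin (n + 1) => (i : ℕ) < p) := by
    ext i
    simp only [Finset.mem_filter, Finset.mem_univ, true_and, Finset.mem_insert, Fin.ext_iff]
    omega
  rw [prefixSum, prefixSum, this, Finset.sum_insert (by simp), add_comm]

lemma prefixSum_of_le (v : Fin (n + 1) → ℤ) {r : ℕ} (h : n + 1 ≤ r) :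
    prefixSum v r = ∑ i, v i := by
  rw [prefixSum, Finset.filter_true_of_mem]
  intro i _
  omega

lemma prefixSum_shift (v : Fin (n + 1) → ℤ) (p q : Fin (n + 1)) (e : ℤ) (r : ℕ) :
    prefixSum (shift v p q e) r =
      prefixSum v r + (if (p : ℕ) < r then e else 0) - (if (q : ℕ) < r then e else 0) := by
  simp [prefixSum, shift, Finset.sum_add_distrib, Finset.sum_sub_distrib, Finset.sum_ite_eq']

lemma prefixSum_le_of_hinge_le {v f : Fin (n + 1) → ℤ} (hf : Antitone f)
    (hs : ∑ k, v k = ∑ k, f k) (h : ∀ c, hinge v c ≤ hinge f c) (r : ℕ) :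
    prefixSum v r ≤ prefixSum f r := by
  rcases lt_or_ge r (n + 1) with hr | hr
  · rcases r with _ | r
    · simp [prefixSum]
    -- At this `c` the positive terms of `hinge f c` all lie in the prefix, so the bound by the
    -- prefix sum is an equality for `f`.
    · set c := f ⟨r, by omega⟩
      have h1 : prefixSum v (r + 1) - ∑ i ∈ Finset.univ.filter fun i : Fin (n + 1) => (i : ℕ) < r + 1, c ≤ hinge v c := by
        rw [prefixSum, ← Finset.sum_sub_distrib]
        refine (Finset.sum_le_sum fun i _ => le_max_left _ 0).trans ?_
        exact Finset.sum_le_sum_of_subset_of_nonneg (Finset.subset_univ _)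
          fun i _ _ => le_max_right _ _
      have h2 : hinge f c = prefixSum f (r + 1) - ∑ i ∈ Finset.univ.filter fun i : Fin (n + 1) => (i : ℕ) < r + 1, c := by
        rw [prefixSum, ← Finset.sum_sub_distrib, hinge, Finset.sum_filter]
        refine Finset.sum_congr rfl fun i _ => ?_
        split_ifs with hi
        · have : c ≤ f i := hf (Fin.le_def.2 (by simp; omega))
          omega
        · have : f i ≤ c := hf (Fin.le_def.2 (by simp; omega))
          omega
      have := h c
      omega
  · rw [prefixSum_of_le v hr, prefixSum_of_le f hr, hs]

/-- Take `p` to be the first index where the vectors differ and `q` the first later index at which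
the prefix sums agree again. Between them the prefix inequalities are strict, so there is room to
add one root. -/
lemma exists_shift_antitone {v f : Fin (n + 1) → ℤ} (hv : Antitone v) (hf : Antitone f)
    (hs : ∑ k, v k = ∑ k, f k) (h : ∀ r, prefixSum v r ≤ prefixSum f r) (hne : v ≠ f) :
    ∃ p q : Fin (n + 1), p < q ∧ Antitone (shift v p q 1) ∧
      ∀ r, prefixSum (shift v p q 1) r ≤ prefixSum f r := by
  obtain ⟨i₀, hi₀⟩ := Function.ne_iff.1 hne
  obtain ⟨p, hp, hpmin⟩ := wellFounded_lt.has_min {i | v i ≠ f i} ⟨i₀, hi₀⟩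
  have hpeq : ∀ i < p, v i = f i := fun i hi => by
    by_contra hn
    exact hpmin i hn hi
  have hSp : prefixSum v p = prefixSum f p := by
    refine Finset.sum_congr rfl fun i hi => hpeq i ?_
    simp only [Finset.mem_filter, Finset.mem_univ, true_and] at hi
    exact hi
  have hvp : v p < f p := by
    have := h (p + 1)
    rw [prefixSum_succ, prefixSum_succ, hSp] at this
    exact lt_of_le_of_ne (by omega) hp
  have hpn : (p : ℕ) < n := by
    by_contra hn
    have h1 := prefixSum_succ v p
    have h2 := prefixSum_succ f p
    rw [prefixSum_of_le _ (by omega)] at h1 h2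
    omega
  obtain ⟨q, ⟨hpq, hq⟩, hqmin⟩ := wellFounded_lt.has_min
    {q : Fin (n + 1) | p < q ∧ prefixSum v (q + 1) = prefixSum f (q + 1)}
    ⟨Fin.last n, Fin.lt_def.2 hpn, by
      rw [prefixSum_of_le _ (by simp), prefixSum_of_le _ (by simp), hs]⟩
  have hstrict : ∀ r : ℕ, (p : ℕ) < r → r ≤ q → prefixSum v r < prefixSum f r := by
    intro r h1 h2
    refine lt_of_le_of_ne (h r) fun he => ?_
    obtain ⟨r, rfl⟩ : ∃ k, r = k + 1 := ⟨r - 1, by omega⟩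
    rcases (Nat.lt_succ_iff.1 h1).eq_or_lt with h3 | h3
    · subst h3
      rw [prefixSum_succ, prefixSum_succ, hSp] at he
      omega
    · exact hqmin ⟨r, by omega⟩ ⟨Fin.lt_def.2 h3, he⟩ (Fin.lt_def.2 (by simp; omega))
  have hvq : f q < v q := by
    have := hstrict q hpq le_rfl
    rw [prefixSum_succ, prefixSum_succ] at hq
    omega
  refine ⟨p, q, hpq, ?_, ?_⟩
  · intro i k hik
    have h1 := hv hik
    have F1 : i < p → v p + 1 ≤ v i := fun hi => by
      have := hf hi.le
      rw [hpeq i hi]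
      omega
    -- The prefix sums agree just after `q`, so the next coordinate of `v` is at most that of `f`,
    -- which is at most `f q < v q`.
    have F2 : q < k → v k + 1 ≤ v q := fun hk => by
      have hlt : (q : ℕ) + 1 < n + 1 := lt_of_le_of_lt (Nat.succ_le_of_lt hk) k.isLt
      let q' : Fin (n + 1) := ⟨q + 1, hlt⟩
      have h3 : v k ≤ v q' := hv (Fin.le_def.2 (Nat.succ_le_of_lt hk))
      have h4 : f q' ≤ f q := hf (Fin.le_def.2 (by simp [q']))
      have h5 := h (q' + 1)
      rw [prefixSum_succ v q', prefixSum_succ f q'] at h5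
      change prefixSum v (q + 1) + v q' ≤ prefixSum f (q + 1) + f q' at h5
      omega
    have e1 : i = p → k ≠ q → shift v p q 1 k ≤ shift v p q 1 i := by
      rintro rfl hk
      simp only [shift, if_neg hk, if_neg hpq.ne]
      split_ifs <;> omega
    by_cases hip : i = p
    · by_cases hk : k = q
      · subst hip hk
        simp only [shift, if_neg hpq.ne, if_neg hpq.ne', if_true]
        omega
      · exact e1 hip hk
    · by_cases hiq : i = q
      · have hkp : k ≠ p := by rintro rfl; exact absurd hik (by rw [hiq]; exact hpq.not_ge)
        by_cases hkq : k = q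
        · rw [hiq, hkq]
        · have := F2 (lt_of_le_of_ne (hiq ▸ hik) (Ne.symm hkq))
          simp only [shift, if_neg hip, if_neg hkp, if_neg hkq, if_pos hiq]
          rw [hiq]
          omega
      · by_cases hkp : k = p
        · have := F1 (lt_of_le_of_ne (hkp ▸ hik) hip)
          simp only [shift, if_neg hip, if_neg hiq, if_pos hkp]
          rw [hkp, if_neg hpq.ne]
          omega
        · simp only [shift, if_neg hip, if_neg hiq, if_neg hkp]
          split_ifs <;> omega
  · intro r
    have h1 := h r
    have h2 := hstrict r
    rw [prefixSum_shift]
    have : (p : ℕ) < q := hpq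
    split_ifs <;> omega

lemma bruhatLE_of_prefixSum_le {v f : Fin (n + 1) → ℤ} (hv : Antitone v) (hf : Antitone f)
    (hs : ∑ k, v k = ∑ k, f k) (h : ∀ r, prefixSum v r ≤ prefixSum f r) :
    bruhatLE (QuotientAddGroup.mk v : Weight n) (QuotientAddGroup.mk f) := by
  induction hk : (∑ r ∈ Finset.range (n + 2), (prefixSum f r - prefixSum v r)).toNat using
    Nat.strong_induction_on generalizing v with
  | h k ih =>
    by_cases hne : v = f
    · rw [hne, bruhatLE_eq]
      exact weightLE_refl 1 _
    · obtain ⟨p, q, hpq, hv', h'⟩ := exists_shift_antitone hv hf hs h hne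
      have hlt : ∑ r ∈ Finset.range (n + 2), (prefixSum f r - prefixSum (shift v p q 1) r) <
          ∑ r ∈ Finset.range (n + 2), (prefixSum f r - prefixSum v r) := by
        have hpq' : (p : ℕ) < q := hpq
        refine Finset.sum_lt_sum (fun r _ => ?_) ⟨p + 1, ?_, ?_⟩
        · rw [prefixSum_shift]
          split_ifs <;> omega
        · simp only [Finset.mem_range]
          omega
        · rw [prefixSum_shift, if_pos (by omega), if_neg (by omega)]
          omega
      have hnn : 0 ≤ ∑ r ∈ Finset.range (n + 2), (prefixSum f r - prefixSum (shift v p q 1) r) :=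
        Finset.sum_nonneg fun r _ => sub_nonneg.2 (h' r)
      have h1 := ih _ (by omega) hv' ((sum_shift _ _ _ _).trans hs) h' rfl
      have h2 := bruhatLE_shift v hpq.ne (e := 1) one_pos
        (Or.inl (by have := hv hpq.le; omega))
      rw [bruhatLE_eq] at *
      exact weightLE_trans h2 h1

lemma bruhatLE_iff_hinge_le {v f : Fin (n + 1) → ℤ} (hf : Antitone f)
    (hs : ∑ k, v k = ∑ k, f k) :
    bruhatLE (QuotientAddGroup.mk v : Weight n) (QuotientAddGroup.mk f) ↔
      ∀ c, hinge v c ≤ hinge f c := by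
  constructor
  · intro h
    rw [bruhatLE_eq] at h
    obtain ⟨x, z, hx, hz, hle⟩ := h
    obtain ⟨w, hw, hws, hwh⟩ := exists_lift_of_twistedLE hle f (mem_coset.1 hz.1).symm
    rw [mem_coset.1 hx.1] at hw
    rwa [← eq_of_mk_eq_of_sum_eq hw (hws.trans hs.symm)]
  · intro h
    obtain ⟨σ, hσ, hle⟩ := exists_antitone_bruhatLE v
    have hs' : ∑ k, (v ∘ σ) k = ∑ k, f k := (Equiv.sum_comp σ v).trans hs
    have h2 := bruhatLE_of_prefixSum_le hσ hf hs'
      (prefixSum_le_of_hinge_le hf hs' fun c => by rw [hinge_comp_perm]; exact h c)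
    rw [bruhatLE_eq] at *
    exact weightLE_trans hle h2

lemma exists_lift_of_bruhatLE {v : Fin (n + 1) → ℤ} {lam : Weight n} (hlam : IsDominant lam)
    (h : bruhatLE (QuotientAddGroup.mk v) lam) :
    ∃ f : Fin (n + 1) → ℤ, QuotientAddGroup.mk f = lam ∧ Antitone f ∧ ∑ k, v k = ∑ k, f k := by
  induction lam using QuotientAddGroup.induction_on with
  | H g =>
    rw [bruhatLE_eq] at h
    obtain ⟨x, z, hx, hz, hle⟩ := h
    obtain ⟨w, hw, hws, -⟩ := exists_lift_of_twistedLE hle g (mem_coset.1 hz.1).symm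
    rw [mem_coset.1 hx.1, QuotientAddGroup.eq] at hw
    obtain ⟨k, hk⟩ := hw
    have hv : ∀ i, v i = w i + k := fun i => by
      have := congrFun hk i
      simp at this
      omega
    refine ⟨fun i => g i + k, ?_, ?_, ?_⟩
    · rw [QuotientAddGroup.eq]
      refine ⟨-k, ?_⟩
      funext i
      simp
    · intro i j hij
      rcases hij.eq_or_lt with rfl | hij
      · exact le_rfl
      · have := hlam i j hij
        rw [pair_mk] at this
        simp only
        omega
    · simp only [hv, Finset.sum_add_distrib, hws]

/-! ### The inversions of the prefixes of the word. -/

lemma height_simpleRoot [NeZero n] (i : Fin (n + 1)) : height (simpleRoot i) = 1 := by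
  unfold height simpleRoot
  simp only
  by_cases h : i = 0
  · subst h
    simp [Fin.coe_neg_one]
  · have : ((i - 1 : Fin (n + 1)) : ℕ) = i - 1 := Fin.val_sub_one_of_ne_zero h
    have h0 : (i : ℕ) ≠ 0 := fun h' => h (Fin.ext h')
    rw [this, if_neg h]
    omega

/-- A simple root has height 1. The reflection lowers the height by at most 1, unless the finite
parts coincide. In that case `β` is the simple root plus a positive multiple of `δ`, and its height
exceeds the possible drop of 2. -/
lemma affRefl_simpleRoot_isPos_of_ne [NeZero n] {i : Fin (n + 1)} {β : AffineRoot n} (h : β.IsPos)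
    (hne : β ≠ simpleRoot i) : (affRefl (simpleRoot i) • β).IsPos := by
  have hn : 1 ≤ n := Nat.one_le_iff_ne_zero.2 (NeZero.ne n)
  have e := height_smul_affRefl 1 (simpleRoot i) β
  have h0 := height_ne_zero (affRefl (simpleRoot i) • β)
  simp only [one_smul, height_simpleRoot, mul_one] at e
  rw [isPos_iff_height] at *
  by_cases h1 : β.i = (simpleRoot i).i ∧ β.j = (simpleRoot i).j
  · obtain ⟨h1, h2⟩ := h1
    have hl : β.level ≠ (simpleRoot i).level := fun hl => hne (AffineRoot.ext h1 h2 hl)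
    have hs := height_simpleRoot i
    have hd : height β = 1 + (n + 1) * (β.level - (simpleRoot i).level) := by
      simp only [height, h1, h2] at hs ⊢
      linear_combination hs
    have hc : rootPairing β (simpleRoot i) ≤ 2 := by
      unfold rootPairing
      split_ifs <;> omega
    have hgt : 0 < β.level - (simpleRoot i).level := by
      by_contra hle
      have : β.level - (simpleRoot i).level ≤ -1 := by omega
      nlinarith
    nlinarith
  · have hc : rootPairing β (simpleRoot i) ≤ 1 := by
      unfold rootPairing
      have := β.ne
      have := (simpleRoot i).ne
      split_ifs <;> omega
    omega

lemma affRefl_simpleRoot_isPos_iff [NeZero n] (i : Fin (n + 1)) (β : AffineRoot n) :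
    (affRefl (simpleRoot i) • β).IsPos ↔
      (β.IsPos ∧ β ≠ simpleRoot i) ∨ β = (simpleRoot i).opp := by
  have hpos : (simpleRoot i).IsPos := by
    rw [isPos_iff_height, height_simpleRoot]
    exact one_pos
  constructor
  · intro h
    by_cases h1 : β.IsPos
    · refine Or.inl ⟨h1, ?_⟩
      rintro rfl
      rw [affRefl_smul_self, isPos_opp] at h
      exact h hpos
    · right
      by_contra h2
      have h3 : β.opp.IsPos := (isPos_opp β).2 h1
      have := affRefl_simpleRoot_isPos_of_ne (i := i) h3
        (fun h4 => h2 (by rw [← opp_opp β, h4]))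
      rw [smul_opp, isPos_opp] at this
      exact this h
  · rintro (⟨h1, h2⟩ | rfl)
    · exact affRefl_simpleRoot_isPos_of_ne h1 h2
    · rwa [smul_opp, affRefl_smul_self, opp_opp]

/-- The number of roots `k δ + ε_n^∨ - ε_i^∨` in the inversion set of `wordPrefix m`. -/
def wallLevel (n m i : ℕ) : ℕ := (m + n - 1 - i) / n

/-- For `i < n`, `wallLevel n m i` counts the `k < m` congruent to `i` modulo `n`: the letters have
period `n + 1`, but the finite parts of the new inversions have period `n`. -/
lemma wallLevel_succ {m i : ℕ} (hi : i < n) :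
    wallLevel n (m + 1) i = wallLevel n m i + if i = m % n then 1 else 0 := by
  unfold wallLevel
  have e : m + 1 + n - 1 - i = (m + n - 1 - i) + 1 := by omega
  rw [e, Nat.succ_div]
  congr 1
  have e' : m + n - 1 - i + 1 = m + (n - i) := by omega
  rw [e']
  have h1 := Nat.mod_lt m (by omega : 0 < n)
  have h2 := Nat.div_add_mod m n
  have : (n ∣ m + (n - i)) ↔ i = m % n := by
    constructor
    · rintro ⟨k, hk⟩
      have h3 : m % n + (n - i) = n * (k - m / n) := by
        rw [Nat.mul_sub]; omega
      have h4 : 0 < k - m / n := by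
        by_contra h0
        rw [Nat.eq_zero_of_not_pos h0] at h3
        omega
      have h5 : k - m / n < 2 := by
        by_contra h0
        have : n * 2 ≤ n * (k - m / n) := Nat.mul_le_mul_left _ (by omega)
        omega
      rw [show k - m / n = 1 by omega] at h3
      omega
    · intro h
      refine ⟨m / n + 1, ?_⟩
      rw [Nat.mul_add]
      omega
  simp only [this]

lemma wallLevel_eq {m i : ℕ} (hi : i < n) :
    wallLevel n m i = m / n + if i < m % n then 1 else 0 := by
  unfold wallLevel
  have h1 := Nat.mod_lt m (by omega : 0 < n)
  have h2 := Nat.div_add_mod m n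
  split_ifs with h
  · rw [Nat.div_eq_of_lt_le]
    · rw [Nat.add_mul, Nat.mul_comm]; omega
    · rw [Nat.add_mul, Nat.add_mul, Nat.mul_comm]; omega
  · rw [Nat.div_eq_of_lt_le]
    · rw [Nat.add_zero, Nat.mul_comm]; omega
    · rw [Nat.add_zero, Nat.add_mul, Nat.mul_comm]; omega

lemma add_mod_succ (m : ℕ) : (m + n) % (n + 1) = if m % (n + 1) = 0 then n else m % (n + 1) - 1 := by
  have h1 := Nat.mod_lt m (by omega : 0 < n + 1)
  have h2 := Nat.div_add_mod m (n + 1)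
  split_ifs with h
  · rw [show m + n = n + (n + 1) * (m / (n + 1)) by omega, Nat.add_mul_mod_self_left,
      Nat.mod_eq_of_lt (by omega)]
  · rw [show m + n = (m % (n + 1) - 1) + (n + 1) * (m / (n + 1) + 1) by rw [Nat.mul_add]; omega,
      Nat.add_mul_mod_self_left, Nat.mod_eq_of_lt (by omega)]

lemma add_div_succ (m : ℕ) :
    (m + n) / (n + 1) = m / (n + 1) + if m % (n + 1) = 0 then 0 else 1 := by
  have h1 := Nat.mod_lt m (by omega : 0 < n + 1)
  have h2 := Nat.div_add_mod m (n + 1)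
  have h3 := Nat.div_add_mod (m + n) (n + 1)
  rw [add_mod_succ] at h3
  have : (n + 1) * ((m + n) / (n + 1)) =
      (n + 1) * (m / (n + 1) + if m % (n + 1) = 0 then 0 else 1) := by
    rw [Nat.mul_add]
    split_ifs at * <;> omega
  exact Nat.eq_of_mul_eq_mul_left (by omega) this

lemma simpleRoot_i_val [NeZero n] (m : ℕ) :
    ((simpleRoot (Fin.ofNat (n + 1) m)).i : ℕ) = (m + n) % (n + 1) := by
  have hn : 1 ≤ n := Nat.one_le_iff_ne_zero.2 (NeZero.ne n)
  change ((Fin.ofNat (n + 1) m - 1 : Fin (n + 1)) : ℕ) = _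
  rw [add_mod_succ]
  split_ifs with h
  · have : Fin.ofNat (n + 1) m = 0 := Fin.ext h
    rw [this]
    simp [Fin.coe_neg_one]
  · exact Fin.val_sub_one_of_ne_zero fun h' => h (congrArg Fin.val h')

lemma simpleRoot_j_val [NeZero n] (m : ℕ) :
    ((simpleRoot (Fin.ofNat (n + 1) m)).j : ℕ) = m % (n + 1) := rfl

lemma simpleRoot_level [NeZero n] (m : ℕ) :
    (simpleRoot (Fin.ofNat (n + 1) m)).level = if m % (n + 1) = 0 then 1 else 0 := by
  have : (Fin.ofNat (n + 1) m = 0) ↔ m % (n + 1) = 0 := by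
    rw [Fin.ext_iff]; rfl
  simp only [simpleRoot, this]

/-- Only `s = 0` is needed later. The offset `s` makes the induction close: removing the last letter
of the prefix turns `s` into `s + 1`, except that `s + 1 = n` wraps round to `0`, where the two
indices of `α` are those of the simple root interchanged. -/
lemma wordPrefix_smul [NeZero n] (m s : ℕ) (hs : s < n) (α : AffineRoot n)
    (hi : (α.i : ℕ) = (m + n) % (n + 1)) (hj : (α.j : ℕ) = (m + s) % (n + 1)) :
    ((wordPrefix (n := n) m • α).i : ℕ) = n ∧ ((wordPrefix (n := n) m • α).j : ℕ) = (m + s) % n ∧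
      (wordPrefix (n := n) m • α).level =
        α.level - ((m + s) / (n + 1) : ℕ) + ((m + n) / (n + 1) : ℕ) + ((m + s) / n : ℕ) := by
  induction m generalizing s α with
  | zero =>
    rw [wordPrefix, one_smul]
    simp only [zero_add] at *
    rw [Nat.mod_eq_of_lt (by omega)] at hi hj
    refine ⟨hi, ?_, ?_⟩
    · rw [hj, Nat.mod_eq_of_lt hs]
    · rw [Nat.div_eq_of_lt (by omega : s < n + 1), Nat.div_eq_of_lt (by omega : n < n + 1),
        Nat.div_eq_of_lt hs]
      simp
  | succ m ih =>
    set σ := simpleRoot (Fin.ofNat (n + 1) m) with hσ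
    have hσi : (σ.i : ℕ) = _ := simpleRoot_i_val m
    have hσj : (σ.j : ℕ) = _ := simpleRoot_j_val m
    have hσl := simpleRoot_level (n := n) m
    rw [← hσ] at hσl
    have hσn := σ.ne
    have e1 : m + 1 + n = m + (n + 1) := by omega
    rw [e1, Nat.add_mod_right] at hi
    have hαi : α.i = σ.j := Fin.ext (by rw [hi, hσj])
    have hd := add_div_succ (n := n) m
    have hN : (m + (n + 1)) / (n + 1) = m / (n + 1) + 1 := Nat.add_div_right m (by omega)
    rw [wordPrefix, mul_smul, e1]
    have hβi : (affRefl σ • α).i = σ.i := by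
      rw [smul_root_i, affRefl_right, hαi, Equiv.swap_apply_right]
    by_cases hsn : s + 1 = n
    · have e2 : m + 1 + s = m + n := by omega
      rw [e2] at hj ⊢
      have hαj : α.j = σ.i := Fin.ext (by rw [hj, hσi])
      have hβj : (affRefl σ • α).j = σ.j := by
        rw [smul_root_j, affRefl_right, hαj, Equiv.swap_apply_left]
      have hβl : (affRefl σ • α).level = α.level + 2 * σ.level := by
        rw [smul_root_level, affRefl_right, affRefl_left, hαi, hαj, Equiv.swap_apply_left,
          Equiv.swap_apply_right, map_zsmul, pair_root]
        simp [hσn, hσn.symm]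
        ring
      obtain ⟨h1, h2, h3⟩ := ih 0 (by omega) (affRefl σ • α) (by rw [hβi, hσi])
        (by rw [hβj, hσj, add_zero])
      refine ⟨h1, ?_, ?_⟩
      · rw [h2, add_zero, Nat.add_mod_right]
      · rw [h3, hβl, hσl, hd, hN, Nat.add_div_right m (by omega), add_zero]
        push_cast
        split_ifs <;> ring
    · have e2 : m + 1 + s = m + (s + 1) := by omega
      rw [e2] at hj ⊢
      have hsmall : ∀ a b : ℕ, a < n + 1 → b < n + 1 →
          (m + a) % (n + 1) = (m + b) % (n + 1) → a = b := by
        intro a b ha hb h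
        have := Nat.ModEq.add_left_cancel' m h
        rwa [Nat.ModEq, Nat.mod_eq_of_lt ha, Nat.mod_eq_of_lt hb] at this
      have hne1 : α.j ≠ σ.i := fun h => by
        have := hsmall (s + 1) n (by omega) (by omega) (by rw [← hj, h, hσi])
        omega
      have hne2 : α.j ≠ σ.j := fun h => by
        have := hsmall (s + 1) 0 (by omega) (by omega) (by rw [← hj, h, hσj, add_zero])
        omega
      have hβj : (affRefl σ • α).j = α.j := by
        rw [smul_root_j, affRefl_right, Equiv.swap_apply_of_ne_of_ne hne1 hne2]
      have hβl : (affRefl σ • α).level = α.level + σ.level := by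
        rw [smul_root_level, affRefl_right, affRefl_left, hαi, Equiv.swap_apply_right,
          Equiv.swap_apply_of_ne_of_ne hne1 hne2, map_zsmul, pair_root]
        simp [hσn, hne1, hne2]
      obtain ⟨h1, h2, h3⟩ := ih (s + 1) (by omega) (affRefl σ • α) (by rw [hβi, hσi])
        (by rw [hβj, hj])
      refine ⟨h1, h2, ?_⟩
      rw [h3, hβl, hσl, hd, hN]
      push_cast
      split_ifs <;> ring

/-- The root of the reflection `wordPrefix (m + 1) * (wordPrefix m)⁻¹`. -/
def wallRoot [NeZero n] (m : ℕ) : AffineRoot n :=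
  wordPrefix (n := n) m • simpleRoot (Fin.ofNat (n + 1) m)

lemma wordPrefix_succ_mul_inv [NeZero n] (m : ℕ) :
    wordPrefix (m + 1) * (wordPrefix m)⁻¹ = affRefl (wallRoot (n := n) m) := by
  rw [wordPrefix, mul_affRefl, mul_inv_cancel_right, wallRoot]

lemma wallRoot_spec [NeZero n] (m : ℕ) :
    ((wallRoot (n := n) m).i : ℕ) = n ∧ ((wallRoot (n := n) m).j : ℕ) = m % n ∧
      (wallRoot (n := n) m).level = (m / n : ℕ) + 1 := by
  have hn : 1 ≤ n := Nat.one_le_iff_ne_zero.2 (NeZero.ne n)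
  obtain ⟨h1, h2, h3⟩ := wordPrefix_smul m 0 (by omega) (simpleRoot (Fin.ofNat (n + 1) m))
    (simpleRoot_i_val m) (simpleRoot_j_val m)
  refine ⟨h1, h2, ?_⟩
  rw [wallRoot, h3, simpleRoot_level, add_div_succ, add_zero]
  push_cast
  split_ifs <;> ring

/-- The largest level `k` such that `k δ + ε_p^∨ - ε_q^∨` is sent to a negative root by the inverse
of `wordPrefix m`. -/
def negLevel (m : ℕ) (p q : Fin (n + 1)) : ℤ :=
  if (p : ℕ) = n then wallLevel n m q
  else if (q : ℕ) = n then -wallLevel n m p - 1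
  else if p < q then -1 else 0

/-- A new letter changes the sign only of `wallRoot m` and its opposite, so exactly two thresholds
move, each by one. -/
lemma wordPrefix_inv_smul_isPos_iff [NeZero n] (m : ℕ) (α : AffineRoot n) :
    ((wordPrefix (n := n) m)⁻¹ • α).IsPos ↔ negLevel m α.i α.j < α.level := by
  have hn : 1 ≤ n := Nat.one_le_iff_ne_zero.2 (NeZero.ne n)
  have hi := α.i.isLt
  have hj := α.j.isLt
  have hne : (α.i : ℕ) ≠ α.j := fun h => α.ne (Fin.ext h)
  induction m with
  | zero =>
    have h0 : ∀ i < n, wallLevel n 0 i = 0 := fun i hi => by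
      rw [wallLevel, Nat.div_eq_of_lt (by omega)]
    rw [wordPrefix, inv_one, one_smul, AffineRoot.IsPos, negLevel]
    simp only [Fin.lt_def]
    split_ifs with h1 h2 h3
    · rw [h0 _ (by omega)]; push_cast; omega
    · rw [h0 _ (by omega)]; push_cast; omega
    · omega
    · omega
  | succ m ih =>
    obtain ⟨g1, g2, g3⟩ := wallRoot_spec (n := n) m
    have hmod := Nat.mod_lt m (by omega : 0 < n)
    have h1 : (wordPrefix (n := n) m)⁻¹ • α = simpleRoot (Fin.ofNat (n + 1) m) ↔ α = wallRoot m := by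
      rw [inv_smul_eq_iff, wallRoot]
    have h2 : (wordPrefix (n := n) m)⁻¹ • α = (simpleRoot (Fin.ofNat (n + 1) m)).opp ↔
        α = (wallRoot m).opp := by
      rw [inv_smul_eq_iff, wallRoot, smul_opp]
    rw [wordPrefix, mul_inv_rev, affRefl_inv, mul_smul, affRefl_simpleRoot_isPos_iff, h2,
      ne_eq, h1, propext ih, AffineRoot.ext_iff, AffineRoot.ext_iff, Fin.ext_iff, Fin.ext_iff, Fin.ext_iff,
      Fin.ext_iff, g1, g2, g3]
    change (_ ∧ ¬ _) ∨ ((α.i : ℕ) = ((wallRoot m).j : ℕ) ∧ (α.j : ℕ) = ((wallRoot m).i : ℕ) ∧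
      α.level = -(wallRoot m).level) ↔ _
    rw [g1, g2, g3]
    have hw : ∀ i < n, wallLevel n m i = m / n + if i < m % n then 1 else 0 :=
      fun i hi => wallLevel_eq hi
    have hw' : ∀ i < n, wallLevel n (m + 1) i = wallLevel n m i + if i = m % n then 1 else 0 :=
      fun i hi => wallLevel_succ hi
    unfold negLevel
    split_ifs with h3 h4 h5
    · rw [hw' _ (by omega)]
      have := hw α.j (by omega)
      split_ifs at * <;> push_cast <;> omega
    · rw [hw' _ (by omega)]
      have := hw α.i (by omega)
      split_ifs at * <;> push_cast <;> omega
    · omega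
    · omega

/-! ### Arrows into a weight as triples `(p, q, e)`. -/

lemma mk_ne_mk_shift (v : Fin (n + 1) → ℤ) {p q : Fin (n + 1)} (h : p ≠ q) {e : ℤ} (he : e ≠ 0) :
    (QuotientAddGroup.mk v : Weight n) ≠ QuotientAddGroup.mk (shift v p q e) := by
  intro heq
  have := congrFun (eq_of_mk_eq_of_sum_eq heq (sum_shift v p q e).symm) p
  simp only [shift, if_true, if_neg h] at this
  omega

lemma weightLT_mk_shift_iff [NeZero n] (m : ℕ) (v : Fin (n + 1) → ℤ) {p q : Fin (n + 1)}
    (h : p ≠ q) {e : ℤ} (he : 0 < e) :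
    weightLT (inversions (wordPrefix m)) (QuotientAddGroup.mk (shift v p q e))
      (QuotientAddGroup.mk v : Weight n) ↔ e ≤ negLevel m p q - v p + v q := by
  let α : AffineRoot n := ⟨p, q, v p - v q + e, h⟩
  have hα : affRefl α • (QuotientAddGroup.mk v : Weight n) =
      QuotientAddGroup.mk (shift v p q e) := by
    rw [affRefl_smul_mk]
    simp [α]
  have hα' : affRefl α.opp • (QuotientAddGroup.mk (shift v p q e) : Weight n) =
      QuotientAddGroup.mk v := by
    rw [affRefl_opp, ← hα, ← mul_smul, affRefl_mul_self, one_smul]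
  have key := weightLT_affRefl_iff (wordPrefix m) α.opp (QuotientAddGroup.mk (shift v p q e))
    (by simp [α, AffineRoot.opp, shift, h, h.symm]; omega)
    (by rw [hα']; exact (mk_ne_mk_shift v h he.ne').symm)
  rw [hα'] at key
  rw [key, smul_opp, isPos_opp, wordPrefix_inv_smul_isPos_iff]
  simp only [α]
  omega

lemma mem_arrowsInto_iff [NeZero n] (m : ℕ) {v f : Fin (n + 1) → ℤ} (hf : Antitone f)
    (hs : ∑ k, v k = ∑ k, f k) (hv : ∀ c, hinge v c ≤ hinge f c) (ν : Weight n) :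
    ν ∈ arrowsInto m (QuotientAddGroup.mk f) (QuotientAddGroup.mk v) ↔
      ∃ p q : Fin (n + 1), ∃ e : ℤ, p ≠ q ∧ 0 < e ∧ e ≤ negLevel m p q - v p + v q ∧
        (∀ c, hinge (shift v p q e) c ≤ hinge f c) ∧ QuotientAddGroup.mk (shift v p q e) = ν := by
  constructor
  · rintro ⟨⟨⟨α, hα⟩, hlt⟩, hle, -⟩
    obtain ⟨p, q, e, hpq, he, hν⟩ : ∃ p q : Fin (n + 1), ∃ e : ℤ, p ≠ q ∧ 0 < e ∧
        QuotientAddGroup.mk (shift v p q e) = ν := by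
      have hν : ν = QuotientAddGroup.mk (shift v α.i α.j (α.level - (v α.i - v α.j))) := by
        rw [← affRefl_smul_mk, ← hα, ← mul_smul, affRefl_mul_self, one_smul]
      rcases lt_trichotomy (α.level - (v α.i - v α.j)) 0 with h | h | h
      · refine ⟨α.j, α.i, -(α.level - (v α.i - v α.j)), α.ne.symm, by omega, ?_⟩
        rw [← shift_neg, neg_neg, hν]
      · exfalso
        apply hlt.2
        rw [hν, h]
        congr 1
        funext k
        simp [shift]
      · exact ⟨α.i, α.j, _, α.ne, h, hν.symm⟩
    subst hν
    refine ⟨p, q, e, hpq, he, (weightLT_mk_shift_iff m v hpq he).1 hlt, ?_, rfl⟩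
    exact (bruhatLE_iff_hinge_le hf ((sum_shift _ _ _ _).trans hs)).1 hle
  · rintro ⟨p, q, e, hpq, he, hle, hh, rfl⟩
    refine ⟨⟨⟨⟨p, q, v p - v q + e, hpq⟩, ?_⟩, (weightLT_mk_shift_iff m v hpq he).2 hle⟩,
      (bruhatLE_iff_hinge_le hf ((sum_shift _ _ _ _).trans hs)).2 hh,
      (bruhatLE_iff_hinge_le hf hs).2 hv⟩
    have : (QuotientAddGroup.mk (shift v p q e) : Weight n) =
        affRefl ⟨p, q, v p - v q + e, hpq⟩ • QuotientAddGroup.mk v := by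
      rw [affRefl_smul_mk]
      simp
    rw [this, ← mul_smul, affRefl_mul_self, one_smul]

open Classical in
/-- The lengths `e > 0` of the arrows to `v` with source `v + e (ε_p - ε_q)`. -/
noncomputable def arrowLengths (m : ℕ) (f v : Fin (n + 1) → ℤ) (p q : Fin (n + 1)) : Finset ℤ :=
  if p = q then ∅ else (Finset.Icc 1 (negLevel m p q - v p + v q)).filter
    fun e => ∀ c, hinge (shift v p q e) c ≤ hinge f c

lemma shift_injective {v : Fin (n + 1) → ℤ} {p q p' q' : Fin (n + 1)} {e e' : ℤ}
    (hpq : p ≠ q) (hpq' : p' ≠ q') (he : 0 < e) (he' : 0 < e')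
    (h : shift v p q e = shift v p' q' e') : p = p' ∧ q = q' ∧ e = e' := by
  have h1 := congrFun h p
  have h2 := congrFun h q
  simp only [shift, if_true, if_neg hpq, if_neg hpq.symm] at h1 h2
  have hp : p = p' := by
    by_contra hn
    rw [if_neg hn] at h1
    split_ifs at h1 <;> omega
  have hq : q = q' := by
    by_contra hn
    rw [if_neg hn] at h2
    split_ifs at h2 <;> omega
  subst hp hq
  rw [if_pos rfl, if_neg hpq] at h1
  exact ⟨rfl, rfl, by omega⟩

lemma arrowsInto_finite_and_ncard [NeZero n] (m : ℕ) {v f : Fin (n + 1) → ℤ} (hf : Antitone f)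
    (hs : ∑ k, v k = ∑ k, f k) (hv : ∀ c, hinge v c ≤ hinge f c) :
    (arrowsInto m (QuotientAddGroup.mk f : Weight n) (QuotientAddGroup.mk v)).Finite ∧
      (arrowsInto m (QuotientAddGroup.mk f : Weight n) (QuotientAddGroup.mk v)).ncard =
        ∑ p, ∑ q, (arrowLengths m f v p q).card := by
  classical
  let S : Finset ((_ : Fin (n + 1) × Fin (n + 1)) × ℤ) :=
    Finset.univ.sigma fun pq => arrowLengths m f v pq.1 pq.2
  let φ : ((_ : Fin (n + 1) × Fin (n + 1)) × ℤ) → Weight n := fun x =>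
    QuotientAddGroup.mk (shift v x.1.1 x.1.2 x.2)
  have hS : ∀ p q e, (⟨(p, q), e⟩ : (_ : Fin (n + 1) × Fin (n + 1)) × ℤ) ∈ S ↔
      p ≠ q ∧ 0 < e ∧ e ≤ negLevel m p q - v p + v q ∧
        ∀ c, hinge (shift v p q e) c ≤ hinge f c := by
    intro p q e
    simp only [S, Finset.mem_sigma, Finset.mem_univ, true_and, arrowLengths]
    split_ifs with h
    · simp [h]
    · simp only [Finset.mem_filter, Finset.mem_Icc, ne_eq, h, not_false_eq_true, true_and, and_assoc]
      rfl
  have himg : arrowsInto m (QuotientAddGroup.mk f : Weight n) (QuotientAddGroup.mk v) =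
      ↑(S.image φ) := by
    ext ν
    rw [mem_arrowsInto_iff m hf hs hv]
    simp only [Finset.coe_image, Set.mem_image, Finset.mem_coe]
    constructor
    · rintro ⟨p, q, e, h1, h2, h3, h4, h5⟩
      exact ⟨⟨(p, q), e⟩, (hS p q e).2 ⟨h1, h2, h3, h4⟩, h5⟩
    · rintro ⟨⟨⟨p, q⟩, e⟩, h, h5⟩
      obtain ⟨h1, h2, h3, h4⟩ := (hS p q e).1 h
      exact ⟨p, q, e, h1, h2, h3, h4, h5⟩
  rw [himg]
  refine ⟨Finset.finite_toSet _, ?_⟩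
  rw [Set.ncard_coe_finset, Finset.card_image_of_injOn, Finset.card_sigma, Fintype.sum_prod_type]
  rintro ⟨⟨p, q⟩, e⟩ h ⟨⟨p', q'⟩, e'⟩ h' heq
  obtain ⟨h1, h2, -⟩ := (hS p q e).1 h
  obtain ⟨h1', h2', -⟩ := (hS p' q' e').1 h'
  obtain ⟨rfl, rfl, rfl⟩ := shift_injective h1 h1' h2 h2'
    (eq_of_mk_eq_of_sum_eq heq ((sum_shift _ _ _ _).trans (sum_shift _ _ _ _).symm))
  rfl

lemma card_arrowLengths_of_forall (m : ℕ) {f v : Fin (n + 1) → ℤ} {p q : Fin (n + 1)} (h : p ≠ q)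
    (hall : ∀ e, 0 < e → e ≤ negLevel m p q - v p + v q →
      ∀ c, hinge (shift v p q e) c ≤ hinge f c) :
    (arrowLengths m f v p q).card = (negLevel m p q - v p + v q).toNat := by
  classical
  rw [arrowLengths, if_neg h, Finset.filter_true_of_mem, Int.card_Icc, add_sub_cancel_right]
  intro e he
  rw [Finset.mem_Icc] at he
  exact hall e (by omega) he.2

/-- For `p` not the last index, `negLevel m p q ≤ 0` forces `v p + e ≤ v q`. The source is then
majorized by `v`, and the bound by `f` is automatic. -/
lemma card_arrowLengths (m : ℕ) {f v : Fin (n + 1) → ℤ} (hv : ∀ c, hinge v c ≤ hinge f c)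
    {p q : Fin (n + 1)} (h : p ≠ q) (hp : (p : ℕ) ≠ n) :
    (arrowLengths m f v p q).card = (negLevel m p q - v p + v q).toNat := by
  refine card_arrowLengths_of_forall m h fun e he hle c =>
    (hinge_shift_le v h he.le ?_ c).trans (hv c)
  have : negLevel m p q ≤ 0 := by
    rw [negLevel, if_neg hp]
    split_ifs <;> omega
  omega

/-! ### Majorization when three coordinates change. -/

/-- Among three numbers at most one is positive or at most one is negative. In the first case the
largest entry controls the sum of positive parts; in the second, the total and the smallest entry
do. -/
lemma sum_max_three_le {a b c x y z x' y' z' M N : ℤ}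
    (h' : a + b + c = x' + y' + z') (hM : a ≤ M ∧ b ≤ M ∧ c ≤ M) (hM' : M ≤ x ∨ M ≤ y ∨ M ≤ z)
    (hN : N ≤ a ∧ N ≤ b ∧ N ≤ c) (hN' : x' ≤ N ∨ y' ≤ N ∨ z' ≤ N) :
    max a 0 + max b 0 + max c 0 ≤ max x 0 + max y 0 + max z 0 ∨
      max a 0 + max b 0 + max c 0 ≤ max x' 0 + max y' 0 + max z' 0 := by
  have key : max a 0 + max b 0 + max c 0 ≤ max M 0 ∨
      max a 0 + max b 0 + max c 0 ≤ a + b + c + max (-N) 0 := by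
    clear h' hM' hN'
    obtain ⟨hM1, hM2, hM3⟩ := hM
    obtain ⟨hN1, hN2, hN3⟩ := hN
    have hm := le_max_left M 0
    have hm' := le_max_right M 0
    have hn := le_max_left (-N) 0
    have hn' := le_max_right (-N) 0
    rcases le_total a 0 with ha | ha <;> rcases le_total b 0 with hb | hb <;>
      rcases le_total c 0 with hc | hc <;> simp only [ha, hb, hc, max_eq_left, max_eq_right] <;>
      first | (left; linarith) | (right; linarith)
  rcases key with key | key
  · left
    refine key.trans ?_
    rcases hM' with hM' | hM' | hM' <;>
      linarith [max_le_max_right 0 hM', le_max_right x 0, le_max_right y 0, le_max_right z 0]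
  · right
    refine key.trans ?_
    rw [h']
    have hneg : ∀ t : ℤ, t + max (-t) 0 = max t 0 := fun t => by omega
    have hle : ∀ t : ℤ, t ≤ N → max (-N) 0 ≤ max (-t) 0 := fun t ht =>
      max_le_max_right 0 (neg_le_neg ht)
    have hx := hneg x'
    have hy := hneg y'
    have hz := hneg z'
    rcases hN' with hN' | hN' | hN' <;>
      linarith [hle _ hN', le_max_left x' 0, le_max_left y' 0, le_max_left z' 0]

/-- `z` controls the maximum of the three coordinates, `z'` their sum and minimum. Which of the two
bounds `w` may depend on `c`. -/
lemma hinge_le_of_three {f w z z' : Fin (n + 1) → ℤ} {i j l : Fin (n + 1)} (hij : i ≠ j)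
    (hil : i ≠ l) (hjl : j ≠ l) (hz : ∀ c, hinge z c ≤ hinge f c)
    (hz' : ∀ c, hinge z' c ≤ hinge f c)
    (hoff : ∀ k, k ≠ i → k ≠ j → k ≠ l → w k = z k ∧ w k = z' k)
    (hs' : w i + w j + w l = z' i + z' j + z' l)
    {M N : ℤ} (hM : w i ≤ M ∧ w j ≤ M ∧ w l ≤ M) (hM' : M ≤ z i ∨ M ≤ z j ∨ M ≤ z l)
    (hN : N ≤ w i ∧ N ≤ w j ∧ N ≤ w l) (hN' : z' i ≤ N ∨ z' j ≤ N ∨ z' l ≤ N) (c : ℤ) :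
    hinge w c ≤ hinge f c := by
  have hdiff : ∀ u : Fin (n + 1) → ℤ, (∀ k, k ≠ i → k ≠ j → k ≠ l → w k = u k) →
      hinge w c - hinge u c = (max (w i - c) 0 + max (w j - c) 0 + max (w l - c) 0) -
        (max (u i - c) 0 + max (u j - c) 0 + max (u l - c) 0) := by
    intro u hu
    rw [hinge, hinge, sum_sub_of_eq_off _ _ {i, j, l}, Finset.sum_insert (by simp [hij, hil]),
      Finset.sum_pair hjl]
    · ring
    · intro k hk
      simp only [Finset.mem_insert, Finset.mem_singleton, not_or] at hk
      rw [hu k hk.1 hk.2.1 hk.2.2]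
  have d1 := hdiff z fun k h1 h2 h3 => (hoff k h1 h2 h3).1
  have d2 := hdiff z' fun k h1 h2 h3 => (hoff k h1 h2 h3).2
  have h1 := hz c
  have h2 := hz' c
  have hsub : ∀ {s t : ℤ}, s ≤ t → s - c ≤ t - c := fun h => sub_le_sub_right h c
  have key := sum_max_three_le (a := w i - c) (b := w j - c) (c := w l - c) (x := z i - c)
    (y := z j - c) (z := z l - c) (x' := z' i - c) (y' := z' j - c) (z' := z' l - c)
    (M := M - c) (N := N - c) (by linarith) ⟨hsub hM.1, hsub hM.2.1, hsub hM.2.2⟩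
    (hM'.imp hsub (Or.imp hsub hsub)) ⟨hsub hN.1, hsub hN.2.1, hsub hN.2.2⟩
    (hN'.imp hsub (Or.imp hsub hsub))
  rcases key with key | key <;> linarith

lemma sum_sum_add_one {ι : Type*} [Fintype ι] [DecidableEq ι] {j l : ι} (hjl : j ≠ l)
    (F G : ι → ι → ℕ) (hdiag : ∀ p, F p p = G p p)
    (hoff : ∀ p q, p ≠ j → p ≠ l → q ≠ j → q ≠ l → F p q = G p q)
    (hrow : ∀ p, p ≠ j → p ≠ l →
      F p j + F j p + (F p l + F l p) = G p j + G j p + (G p l + G l p))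
    (hpair : F j l + F l j + 1 = G j l + G l j) :
    ∑ p, ∑ q, F p q + 1 = ∑ p, ∑ q, G p q := by
  let E : Finset ι := Finset.univ.filter fun p => p ≠ j ∧ p ≠ l
  have hE : ∀ h : ι → ℕ, ∑ p, h p = h j + h l + ∑ p ∈ E, h p := by
    intro h
    have : (Finset.univ : Finset ι) = insert j (insert l E) := by
      ext p
      simp only [E, Finset.mem_univ, Finset.mem_insert, Finset.mem_filter, true_and, true_iff]
      tauto
    rw [this, Finset.sum_insert (by simp [E, hjl]), Finset.sum_insert (by simp [E]), add_assoc]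
  have hEE : ∑ p ∈ E, ∑ q ∈ E, F p q = ∑ p ∈ E, ∑ q ∈ E, G p q := by
    refine Finset.sum_congr rfl fun p hp => Finset.sum_congr rfl fun q hq => ?_
    simp only [E, Finset.mem_filter, Finset.mem_univ, true_and] at hp hq
    exact hoff p q hp.1 hp.2 hq.1 hq.2
  have hE1 : ∑ p ∈ E, (F p j + F j p + (F p l + F l p)) =
      ∑ p ∈ E, (G p j + G j p + (G p l + G l p)) := by
    refine Finset.sum_congr rfl fun p hp => ?_
    simp only [E, Finset.mem_filter, Finset.mem_univ, true_and] at hp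
    exact hrow p hp.1 hp.2
  simp only [hE, Finset.sum_add_distrib] at hE1 ⊢
  have h1 := hdiag j
  have h2 := hdiag l
  omega

/-- At `i`, `j`, `l` neither source goes below `v j - d = v l - K`, a value attained by `shift v l j
d`. If `v i ≤ v l + e`, both sources have maximum `v l + e` there, so each bounds the other with the
help of `shift v l j d`. Otherwise the maxima are at most `v i`, which `shift v l j d` attains, and
both sides hold. -/
lemma hinge_shift_le_iff {f v : Fin (n + 1) → ℤ} {i j l : Fin (n + 1)} (hij : i ≠ j)
    (hil : i ≠ l) (hjl : j ≠ l) {K κ d e : ℤ} (hK : 1 ≤ K) (hκ : κ ≤ K)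
    (hd : d = v j - v l + K) (hd0 : 0 < d)
    (hv' : ∀ c, hinge (shift v l j d) c ≤ hinge f c) (he : d < e) (he' : e ≤ κ - v l + v i) :
    (∀ c, hinge (shift (shift v l j d) l i (e - d)) c ≤ hinge f c) ↔
      ∀ c, hinge (shift v l i e) c ≤ hinge f c := by
  have hji := hij.symm
  have hli := hil.symm
  have hlj := hjl.symm
  have w : ∀ k, k ≠ i → k ≠ j → k ≠ l → shift v l i e k = v k := fun k h1 h2 h3 => by
    simp [shift, h1, h3]
  have w' : ∀ k, k ≠ i → k ≠ j → k ≠ l → shift v l j d k = v k := fun k h1 h2 h3 => by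
    simp [shift, h2, h3]
  have w'' : ∀ k, k ≠ i → k ≠ j → k ≠ l → shift (shift v l j d) l i (e - d) k = v k :=
    fun k h1 h2 h3 => by simp [shift, h1, h2, h3]
  have ai : shift v l i e i = v i - e := by simp [shift, hil]
  have aj : shift v l i e j = v j := by simp [shift, hjl, hji]
  have al : shift v l i e l = v l + e := by simp [shift, hli]
  have bi : shift v l j d i = v i := by simp [shift, hil, hij]
  have bj : shift v l j d j = v j - d := by simp [shift, hjl]
  have bl : shift v l j d l = v l + d := by simp [shift, hlj]
  have ci : shift (shift v l j d) l i (e - d) i = v i - (e - d) := by simp [shift, hil, hij]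
  have cj : shift (shift v l j d) l i (e - d) j = v j - d := by simp [shift, hjl, hji]
  have cl : shift (shift v l j d) l i (e - d) l = v l + e := by simp [shift, hlj, hli]
  constructor
  · intro h
    rcases le_total (v i) (v l + e) with hx | hx
    · refine hinge_le_of_three hij hil hjl h hv' (fun k h1 h2 h3 => ?_) ?_
        (M := v l + e) (N := v j - d) ?_ ?_ ?_ ?_ <;>
        first | (rw [w k h1 h2 h3, w' k h1 h2 h3, w'' k h1 h2 h3]; exact ⟨rfl, rfl⟩) | skip
      all_goals simp only [ai, aj, al, bi, bj, bl, ci, cj, cl]; omega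
    · refine hinge_le_of_three hij hil hjl hv' hv' (fun k h1 h2 h3 => ?_) ?_
        (M := v i) (N := v j - d) ?_ ?_ ?_ ?_ <;>
        first | (rw [w k h1 h2 h3, w' k h1 h2 h3]; exact ⟨rfl, rfl⟩) | skip
      all_goals simp only [ai, aj, al, bi, bj, bl]; omega
  · intro h
    rcases le_total (v i) (v l + e) with hx | hx
    · refine hinge_le_of_three hij hil hjl h hv' (fun k h1 h2 h3 => ?_) ?_
        (M := v l + e) (N := v j - d) ?_ ?_ ?_ ?_ <;>
        first | (rw [w k h1 h2 h3, w' k h1 h2 h3, w'' k h1 h2 h3]; exact ⟨rfl, rfl⟩) | skip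
      all_goals simp only [ai, aj, al, bi, bj, bl, ci, cj, cl]; omega
    · refine hinge_le_of_three hij hil hjl hv' hv' (fun k h1 h2 h3 => ?_) ?_
        (M := v i) (N := v j - d) ?_ ?_ ?_ ?_ <;>
        first | (rw [w'' k h1 h2 h3, w' k h1 h2 h3]; exact ⟨rfl, rfl⟩) | skip
      all_goals simp only [bi, bj, bl, ci, cj, cl]; omega

lemma hinge_shift_le_of_le {f v : Fin (n + 1) → ℤ} {i j l : Fin (n + 1)} (hij : i ≠ j)
    (hil : i ≠ l) (hjl : j ≠ l) {K κ d e : ℤ} (hK : 1 ≤ K) (hκ : κ ≤ K)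
    (hd : d = v j - v l + K) (hd0 : 0 < d)
    (hv' : ∀ c, hinge (shift v l j d) c ≤ hinge f c) (he0 : 0 < e) (he : e ≤ d)
    (he' : e ≤ κ - v l + v i) (c : ℤ) : hinge (shift v l i e) c ≤ hinge f c := by
  have hji := hij.symm
  have hli := hil.symm
  have hlj := hjl.symm
  have ai : shift v l i e i = v i - e := by simp [shift, hil]
  have aj : shift v l i e j = v j := by simp [shift, hjl, hji]
  have al : shift v l i e l = v l + e := by simp [shift, hli]
  have bi : shift v l j d i = v i := by simp [shift, hil, hij]
  have bj : shift v l j d j = v j - d := by simp [shift, hjl]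
  have bl : shift v l j d l = v l + d := by simp [shift, hlj]
  refine hinge_le_of_three hij hil hjl hv' hv' (fun k h1 h2 h3 => ?_) ?_
    (M := max (v i) (v l + d)) (N := v j - d) ?_ ?_ ?_ ?_ c
  · simp [shift, h1, h2, h3]
  all_goals simp only [ai, aj, al, bi, bj, bl]; omega

/-! ### Comparing the counts at `v` and at its reflection. -/

/-- The excluded lengths are matched by `e ↦ e - d`: none at `v` is `≤ d` (`hinge_shift_le_of_le`),
and beyond `d` the two tests agree (`hinge_shift_le_iff`). Subtraction is avoided by adding the full
ranges crosswise. -/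
lemma card_arrowLengths_add (m : ℕ) {f v : Fin (n + 1) → ℤ} {i j l : Fin (n + 1)} (hij : i ≠ j)
    (hil : i ≠ l) (hjl : j ≠ l) {K d : ℤ} (hK : 1 ≤ K) (hκ : negLevel m l i ≤ K)
    (hd : d = v j - v l + K) (hd0 : 0 < d)
    (hv' : ∀ c, hinge (shift v l j d) c ≤ hinge f c) :
    (arrowLengths m f v l i).card + (negLevel m l i - (v l + d) + v i).toNat =
      (arrowLengths m f (shift v l j d) l i).card + (negLevel m l i - v l + v i).toNat := by
  classical
  have bi : shift v l j d i = v i := by simp [shift, hil, hij]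
  have bl : shift v l j d l = v l + d := by simp [shift, hjl.symm]
  simp only [arrowLengths, if_neg hil.symm, bi, bl]
  set κ := negLevel m l i
  have h1 := Finset.card_filter_add_card_filter_not (s := Finset.Icc 1 (κ - v l + v i))
    (fun e => ∀ c, hinge (shift v l i e) c ≤ hinge f c)
  have h2 := Finset.card_filter_add_card_filter_not (s := Finset.Icc 1 (κ - (v l + d) + v i))
    (fun e => ∀ c, hinge (shift (shift v l j d) l i e) c ≤ hinge f c)
  have h3 : ((Finset.Icc 1 (κ - v l + v i)).filter
        fun e => ¬ ∀ c, hinge (shift v l i e) c ≤ hinge f c).card =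
      ((Finset.Icc 1 (κ - (v l + d) + v i)).filter
        fun e => ¬ ∀ c, hinge (shift (shift v l j d) l i e) c ≤ hinge f c).card := by
    refine Finset.card_nbij' (fun e => e - d) (fun e => e + d) ?_ ?_ (fun e _ => by ring)
      (fun e _ => by ring)
    · intro e he
      simp only [Finset.coe_filter, Finset.mem_Icc, Set.mem_ofPred_eq] at he ⊢
      obtain ⟨⟨he0, hle⟩, hnot⟩ := he
      have hlt : d < e := by
        by_contra hn
        exact hnot (hinge_shift_le_of_le hij hil hjl hK hκ hd hd0 hv' (by omega) (by omega) hle)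
      refine ⟨by omega, ?_⟩
      rwa [hinge_shift_le_iff hij hil hjl hK hκ hd hd0 hv' hlt hle]
    · intro e he
      simp only [Finset.coe_filter, Finset.mem_Icc, Set.mem_ofPred_eq] at he ⊢
      obtain ⟨⟨he0, hle⟩, hnot⟩ := he
      refine ⟨by omega, ?_⟩
      rwa [← hinge_shift_le_iff hij hil hjl hK hκ hd hd0 hv' (by omega) (by omega),
        add_sub_cancel_right]
  rw [Int.card_Icc, add_sub_cancel_right] at h1 h2
  omega

lemma sum_card_arrowLengths [NeZero n] (m : ℕ) {f v : Fin (n + 1) → ℤ} {j l : Fin (n + 1)}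
    (hl : (l : ℕ) = n) (hj : (j : ℕ) = m % n) {d : ℤ} (hd : d = v j - v l + ((m / n : ℕ) + 1))
    (hd0 : 0 < d) (hv : ∀ c, hinge v c ≤ hinge f c)
    (hv' : ∀ c, hinge (shift v l j d) c ≤ hinge f c) :
    ∑ p, ∑ q, (arrowLengths m f v p q).card + 1 =
      ∑ p, ∑ q, (arrowLengths m f (shift v l j d) p q).card := by
  have hn : 0 < n := Nat.pos_of_ne_zero (NeZero.ne n)
  have hmod := Nat.mod_lt m hn
  have hjn : (j : ℕ) ≠ n := by omega
  have hjl : j ≠ l := fun h => hjn (h ▸ hl)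
  have bj : shift v l j d j = v j - d := by simp [shift, hjl]
  have bl : shift v l j d l = v l + d := by simp [shift, hjl.symm]
  have hlast : ∀ p : Fin (n + 1), p ≠ l → (p : ℕ) ≠ n := fun p hp h => hp (Fin.ext (h.trans hl.symm))
  refine sum_sum_add_one hjl _ _ ?_ ?_ ?_ ?_
  · intro p
    simp [arrowLengths]
  · intro p q hpj hpl hqj hql
    by_cases hpq : p = q
    · simp [arrowLengths, hpq]
    · rw [card_arrowLengths m hv hpq (hlast p hpl), card_arrowLengths m hv' hpq (hlast p hpl)]
      simp [shift, hpj, hpl, hqj, hql]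
  · intro i hij hil
    have hin := hlast i hil
    have bi : shift v l j d i = v i := by simp [shift, hil, hij]
    have hw := wallLevel_eq (m := m) (n := n) (i := i) (by omega)
    have nl : negLevel m l i = wallLevel n m i := by rw [negLevel, if_pos hl]
    have nl' : negLevel m i l = -wallLevel n m i - 1 := by rw [negLevel, if_neg hin, if_pos hl]
    have nij : negLevel m i j = if i < j then -1 else 0 := by
      rw [negLevel, if_neg hin, if_neg hjn]
    have nji : negLevel m j i = if j < i then -1 else 0 := by
      rw [negLevel, if_neg hjn, if_neg hin]
    have hκ : negLevel m l i ≤ (m / n : ℕ) + 1 := by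
      rw [nl, hw]
      split_ifs <;> push_cast <;> omega
    -- The full ranges in `key` equal the counts for `(j, i)`: `negLevel m l i` minus the level of
    -- the wall is `-1` if `j < i` and `0` if `i < j`, which is `negLevel m j i`.
    have key := card_arrowLengths_add m hij hil hjl (le_add_of_nonneg_left (Int.natCast_nonneg _)) hκ hd hd0 hv'
    rw [card_arrowLengths m hv hij hin, card_arrowLengths m hv hij.symm hjn,
      card_arrowLengths m hv hil hin, card_arrowLengths m hv' hij hin,
      card_arrowLengths m hv' hij.symm hjn, card_arrowLengths m hv' hil hin, bi, bj, bl]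
    have hne : (i : ℕ) ≠ j := fun h => hij (Fin.ext h)
    rw [nl] at key
    rw [nl', nij, nji]
    simp only [Fin.lt_def]
    rw [← hj] at hw
    rcases lt_or_gt_of_ne hne with h | h
    · rw [if_pos h] at hw
      rw [if_pos h, if_neg (by omega)]
      rw [hw] at key ⊢
      omega
    · rw [if_neg (by omega)] at hw
      rw [if_neg (by omega), if_pos h]
      rw [hw] at key ⊢
      omega
  -- For the pair `j`, `l` itself, there are `d - 1` arrows into `v`, all in direction `(l, j)`, and
  -- `d` arrows into the reflected vector, all in direction `(j, l)`.
  · have hw := wallLevel_eq (m := m) (n := n) (i := j) (by omega)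
    rw [if_neg (by omega), add_zero] at hw
    have nl : negLevel m l j = (m / n : ℕ) := by rw [negLevel, if_pos hl, hw]
    have nl' : negLevel m j l = -(m / n : ℕ) - 1 := by rw [negLevel, if_neg hjn, if_pos hl, hw]
    have h1 : (arrowLengths m f v l j).card = (negLevel m l j - v l + v j).toNat := by
      refine card_arrowLengths_of_forall m hjl.symm fun e he hle c => ?_
      -- Since `e < d`, the source lies on the segment from `v` to its reflection, hence is
      -- majorized by the latter.
      have hsh : shift v l j e = shift (shift v l j d) j l (d - e) := by
        rw [← neg_sub, shift_neg]
        funext k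
        simp only [shift]
        split_ifs <;> ring
      rw [hsh]
      refine (hinge_shift_le _ hjl (by omega) ?_ c).trans (hv' c)
      rw [bj, bl]
      omega
    have h2 : (arrowLengths m f (shift v l j d) l j).card = 0 := by
      rw [Finset.card_eq_zero, arrowLengths, if_neg hjl.symm, Finset.Icc_eq_empty,
        Finset.filter_empty]
      rw [nl, bj, bl]
      omega
    rw [h1, h2, card_arrowLengths m hv hjl hjn, card_arrowLengths m hv' hjl hjn, nl, nl', bj, bl]
    omega

end AffineA

theorem proposition2p11 {n : ℕ} [NeZero n] (m : ℕ) (t : AffineA.ExtWeyl n)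
    (ht : t = AffineA.wordPrefix (m + 1) * (AffineA.wordPrefix m)⁻¹)
    (μ lam : AffineA.Weight n) (hlam : AffineA.IsDominant lam)
    (hμt : AffineA.bruhatLT μ (t • μ)) (htlam : AffineA.bruhatLE (t • μ) lam) :
    (AffineA.arrowsInto m lam μ).Finite ∧ (AffineA.arrowsInto m lam (t • μ)).Finite ∧
      ((AffineA.arrowsInto m lam μ).ncard : ℤ) =
        ((AffineA.arrowsInto m lam (t • μ)).ncard : ℤ) - 1 := by
  open AffineA in
  rw [wordPrefix_succ_mul_inv] at ht
  subst ht
  obtain ⟨hi, hj, hlev⟩ := wallRoot_spec (n := n) m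
  set γ := wallRoot (n := n) m
  induction μ using QuotientAddGroup.induction_on with
  | H v =>
    have hγ : (γ : AffineRoot n).IsPos := Or.inl (by rw [hlev]; positivity)
    have hlt : bruhatLT (QuotientAddGroup.mk v : Weight n) (affRefl γ • QuotientAddGroup.mk v) ↔
        weightLT (inversions 1) (QuotientAddGroup.mk v : Weight n)
          (affRefl γ • QuotientAddGroup.mk v) := by
      rw [inversions_one]; rfl
    -- As `γ` is positive, the untwisted order goes up under its reflection only if `v` is on the
    -- side where the pairing is below the level.
    have hd0 : 0 < γ.level - (v γ.i - v γ.j) := by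
      rcases lt_trichotomy (γ.level - (v γ.i - v γ.j)) 0 with h | h | h
      · exfalso
        have := (weightLT_affRefl_iff 1 γ.opp (QuotientAddGroup.mk v)
          (by simp only [pair_mk, AffineRoot.opp]; omega)
          (by rw [affRefl_opp]; exact hμt.2)).1 (by rw [affRefl_opp]; exact hlt.1 hμt)
        rw [inv_one, one_smul, isPos_opp] at this
        exact this hγ
      · exfalso
        apply hμt.2
        rw [affRefl_smul_mk, h]
        congr 1
        funext k
        simp [shift]
      · exact h
    have hle : bruhatLE (QuotientAddGroup.mk v : Weight n) lam := by
      have h1 := (hlt.1 hμt).1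
      rw [bruhatLE_eq] at *
      exact weightLE_trans h1 htlam
    obtain ⟨f, rfl, hf, hs⟩ := exists_lift_of_bruhatLE hlam hle
    rw [affRefl_smul_mk] at htlam ⊢
    have hs' := (sum_shift v γ.i γ.j (γ.level - (v γ.i - v γ.j))).trans hs
    rw [bruhatLE_iff_hinge_le hf hs] at hle
    rw [bruhatLE_iff_hinge_le hf hs'] at htlam
    obtain ⟨h1, h2⟩ := arrowsInto_finite_and_ncard m hf hs hle
    obtain ⟨h3, h4⟩ := arrowsInto_finite_and_ncard m hf hs' htlam
    refine ⟨h1, h3, ?_⟩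
    rw [h2, h4, ← sum_card_arrowLengths m hi hj (by rw [hlev]; ring) hd0 hle htlam]
    push_cast
    ring
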